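/- Let $\mathbb{X}$ be a compact metric space and let $C(\mathbb{X})$ be the Banach space of continuous real functions on $\mathbb{X}$ with the supremum norm and its Borel $\sigma$-algebra. Let $\xi = (\xi(x))_{x \in \mathbb{X}}$ be a real Gaussian process with continuous sample paths on a probability space $(\Omega, \mathcal{F}, \mathsf{P})$, viewed as a random element of $C(\mathbb{X})$. Let $\tau : \mathbb{X} \to [0, \infty)$ be continuous, and let $(U_n)_{n \ge 1}$ be i.i.d. $\mathcal{N}(0,1)$ random variables, independent of $\xi$. Given random points $X_1, X_2, \ldots$ of $\mathbb{X}$, let $$Z_n = \xi(X_n) + \tau(X_n)\, U_n, \qquad n \ge 1,$$ let $\mathcal{F}_n$ be the $\sigma$-algebra generated by $X_1, Z_1, \ldots, X_n, Z_n$ (with $\mathcal{F}_0$ trivial), and let $\mathcal{F}_\infty = \bigvee_{n \ge 1} \mathcal{F}_n$. The sequence $(X_n)_{n \ge 1}$ is called a sequential design if $X_n$ is $\mathcal{F}_{n-1}$-measurable for every $n \ge 1$. Let $\mathbb{M}$ be the set of all Gaussian measures on $C(\mathbb{X})$, with the $\sigma$-algebra generated by the evaluation maps $\nu \mapsto \nu(A)$,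 $A \subset C(\mathbb{X})$ Borel. For $\nu \in \mathbb{M}$ let $m_\nu(x) = \int f(x)\, \nu(df)$ be its mean function and $k_\nu(x,y) = \int (f(x) - m_\nu(x)) (f(y) - m_\nu(y))\, \nu(df)$ its covariance function. For $\nu_n, \nu_\infty \in \mathbb{M}$ write $\nu_n \to \nu_\infty$ if $m_{\nu_n} \to m_{\nu_\infty}$ uniformly on $\mathbb{X}$ and $k_{\nu_n} \to k_{\nu_\infty}$ uniformly on $\mathbb{X} \times \mathbb{X}$. Then, for every sequential design $(X_n)_{n \ge 1}$: 1. for every $n \ge 0$, the conditional distribution of $\xi$ given $\mathcal{F}_n$ admits a version which is an $\mathcal{F}_n$-measurable random element of $\mathbb{M}$; 2. the conditional distribution of $\xi$ given $\mathcal{F}_\infty$ admits a version $\mathsf{P}_\infty^\xi$ which is an $\mathcal{F}_\infty$-measurable random element of $\mathbb{M}$, and for any versions $\mathsf{P}_n^\xi$, $n \ge 0$, as in 1., one has $\mathsf{P}_n^\xi \to \mathsf{P}_\infty^\xi$ almost surely. -/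

import Mathlib

open MeasureTheory ProbabilityTheory Filter Topology

namespace SequentialDesign

/-- The Borel sigma-algebra of the Banach space `C(𝕏, ℝ)` (supremum norm). -/
instance instMeasurableSpaceContinuousMap {𝕏 : Type*} [TopologicalSpace 𝕏] :
    MeasurableSpace C(𝕏, ℝ) := borel _

instance instBorelSpaceContinuousMap {𝕏 : Type*} [TopologicalSpace 𝕏] :
    BorelSpace C(𝕏, ℝ) := ⟨rfl⟩

/-- The set of all Gaussian measures on `C(𝕏, ℝ)`. As a subtype of `Measure C(𝕏, ℝ)` it carries
the sigma-algebra generated by the evaluation maps `ν ↦ ν A`, `A` Borel. -/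
abbrev GaussianMeasure (𝕏 : Type*) [TopologicalSpace 𝕏] : Type _ :=
  {ν : Measure C(𝕏, ℝ) // IsGaussian ν}

/-- The mean function `m_ν` of a Gaussian measure on `C(𝕏, ℝ)`. -/
noncomputable def meanFun {𝕏 : Type*} [TopologicalSpace 𝕏] (ν : GaussianMeasure 𝕏) (x : 𝕏) : ℝ :=
  ∫ f : C(𝕏, ℝ), f x ∂(ν : Measure C(𝕏, ℝ))

/-- The covariance function `k_ν` of a Gaussian measure on `C(𝕏, ℝ)`. -/
noncomputable def covFun {𝕏 : Type*} [TopologicalSpace 𝕏] (ν : GaussianMeasure 𝕏)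
    (p : 𝕏 × 𝕏) : ℝ :=
  covariance (fun f : C(𝕏, ℝ) ↦ f p.1) (fun f : C(𝕏, ℝ) ↦ f p.2) (ν : Measure C(𝕏, ℝ))

/-- Convergence of Gaussian measures: the mean functions converge uniformly on `𝕏` and the
covariance functions converge uniformly on `𝕏 × 𝕏`. -/
def GaussianTendsto {𝕏 : Type*} [TopologicalSpace 𝕏] (ν : ℕ → GaussianMeasure 𝕏)
    (νinf : GaussianMeasure 𝕏) : Prop :=
  TendstoUniformly (fun n ↦ meanFun (ν n)) (meanFun νinf) atTop ∧
    TendstoUniformly (fun n ↦ covFun (ν n)) (covFun νinf) atTop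

/-- The noisy observations `Z n = ξ (X n) + τ (X n) * U n`. Indices start at `0`: `X n`, `U n` and
`Z n` are the design point, noise variable and observation number `n + 1`. -/
def observation {Ω 𝕏 : Type*} [TopologicalSpace 𝕏] (ξ : Ω → C(𝕏, ℝ)) (τ : 𝕏 → ℝ)
    (U : ℕ → Ω → ℝ) (X : ℕ → Ω → 𝕏) (n : ℕ) (ω : Ω) : ℝ :=
  ξ ω (X n ω) + τ (X n ω) * U n ω

/-- The sigma-algebra generated by the first `n` design points and the first `n` observations. -/
abbrev obsSigma {Ω 𝕏 : Type*} [TopologicalSpace 𝕏] [MeasurableSpace 𝕏] (ξ : Ω → C(𝕏, ℝ))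
    (τ : 𝕏 → ℝ) (U : ℕ → Ω → ℝ) (X : ℕ → Ω → 𝕏) (n : ℕ) : MeasurableSpace Ω :=
  ⨆ i : Fin n, (MeasurableSpace.comap (X i) inferInstance ⊔
    MeasurableSpace.comap (observation ξ τ U X i) inferInstance)

/-- The sigma-algebra generated by all the design points and all the observations. -/
abbrev obsSigmaInf {Ω 𝕏 : Type*} [TopologicalSpace 𝕏] [MeasurableSpace 𝕏] (ξ : Ω → C(𝕏, ℝ))
    (τ : 𝕏 → ℝ) (U : ℕ → Ω → ℝ) (X : ℕ → Ω → 𝕏) : MeasurableSpace Ω :=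
  ⨆ n, obsSigma ξ τ U X n

/-- A (non-randomized) sequential design: each design point is a measurable function of the
preceding design points and observations (the first one is deterministic). -/
def IsSequentialDesign {Ω 𝕏 : Type*} [TopologicalSpace 𝕏] [MeasurableSpace 𝕏] (ξ : Ω → C(𝕏, ℝ))
    (τ : 𝕏 → ℝ) (U : ℕ → Ω → ℝ) (X : ℕ → Ω → 𝕏) : Prop :=
  ∀ n, Measurable[obsSigma ξ τ U X n] (X n)

/-- `P` is an `ℱ'`-measurable random element of the space of Gaussian measures on `C(𝕏, ℝ)`, and
it is a version of the conditional distribution of `ξ` given `ℱ'`. -/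
structure IsGaussianCondLaw {Ω 𝕏 : Type*} [TopologicalSpace 𝕏] {mΩ : MeasurableSpace Ω}
    (μ : Measure Ω) (ξ : Ω → C(𝕏, ℝ)) (ℱ' : MeasurableSpace Ω)
    (P : Ω → GaussianMeasure 𝕏) : Prop where
  measurable : Measurable[ℱ'] P
  ae_eq_condExp : ∀ A : Set C(𝕏, ℝ), MeasurableSet A →
    (fun ω ↦ (P ω : Measure C(𝕏, ℝ)).real A) =ᵐ[μ] μ⟦ξ ⁻¹' A | ℱ'⟧

end SequentialDesign

/-!
The argument works with the conditional laws themselves, as kernels into `C(𝕏, ℝ)`.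

*Finitely many observations.* The process has a Gaussian law on `C(𝕏, ℝ)`: every continuous linear
functional is a pointwise limit of finite combinations of evaluations (`exists_tendsto_ratEval`), and
pointwise limits of Gaussian variables are Gaussian (`hasGaussianLaw_of_tendsto`). Suppose that,
given `ℱ'`, the process has a Gaussian law `ν`, and that `z = f x + τ x * u` is observed, where `x`
is `ℱ'`-measurable and `u` is a standard Gaussian variable independent of the past. Under
`ν ⊗ 𝒩(0, 1)` the residual of the regression of `f` on `z` is jointly Gaussian and uncorrelated with
`z`, hence independent of it (`indepFun_residual_noisyObs`). So the law of the residual, translated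
by `z` times the regression coefficient, is the conditional law of `f` given `ℱ'` and `z`
(`map_prodMk_eq_compProd_updateKernel`), and it is Gaussian and depends measurably on the
data. The noise `U n` is independent of the process and of the first `n` observations
(`IsSequentialDesign.indep_noise`), so this step can be iterated along the design.

*The limit.* For a continuous function `g` on `C(𝕏, ℝ)`, integrable under the law of the process,
`∫ g dP_n` is the conditional expectation of `g ξ`, and converges almost surely to `∫ g dP_∞` by
Lévy's upward theorem (`ae_tendsto_integral`). With countably many `g` (first and second moments and
trigonometric functions of rational combinations of evaluations) this shows that the conditional law
given the limit sigma-algebra is almost surely Gaussian (`exists_isGaussianCondLaw_iSup`). With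
countably many others it gives the uniform convergence (`gaussianTendsto_of_tendsto_integral`):
interpolation at finitely many points of a dense sequence approximates means and covariances
uniformly on `𝕏`, with errors bounded by integrals of `‖f - R f‖` and `‖f - R f‖ * ‖f‖`, `R f` being
the interpolant of `f`. These integrals converge along the filtration, and their limits are small
when the interpolation is fine.
-/

namespace SequentialDesign

/-! ### Interpolation in `C(𝕏, ℝ)` -/

section Interpolation

variable {𝕏 : Type*} [TopologicalSpace 𝕏]

/-- A sequence of finite partitions of unity `φ k i`, `i ∈ t k`, attached to a sequence of points
`d i` of `𝕏`, such that the interpolants `∑ i ∈ t k, f (d i) • φ k i` of every continuous function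
`f` converge uniformly to `f`. -/
structure InterpolationScheme (d : ℕ → 𝕏) (t : ℕ → Finset ℕ) (φ : ℕ → ℕ → C(𝕏, ℝ)) : Prop where
  nonneg : ∀ k i y, 0 ≤ φ k i y
  sum_eq_one : ∀ k y, ∑ i ∈ t k, φ k i y = 1
  tendsto : ∀ f : C(𝕏, ℝ), Tendsto (fun k ↦ ∑ i ∈ t k, f (d i) • φ k i) atTop (𝓝 f)

theorem InterpolationScheme.le_one {d : ℕ → 𝕏} {t : ℕ → Finset ℕ} {φ : ℕ → ℕ → C(𝕏, ℝ)}
    (h : InterpolationScheme d t φ) {k i : ℕ}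
    (hi : i ∈ t k) (y : 𝕏) : φ k i y ≤ 1 := by
  rw [← h.sum_eq_one k y]
  exact Finset.single_le_sum (fun j _ ↦ h.nonneg k j y) hi

/-- The `k`-th partition of unity is subordinate to the balls of radius `1 / (k + 1)` around the
points `d i`; uniform continuity gives the convergence of the interpolants. -/
theorem exists_interpolationScheme {𝕏 : Type*} [MetricSpace 𝕏] [CompactSpace 𝕏] {d : ℕ → 𝕏}
    (hd : DenseRange d) : ∃ t φ, InterpolationScheme d t φ := by
  have key : ∀ k : ℕ, ∃ (t : Finset ℕ) (φ : ℕ → C(𝕏, ℝ)), (∀ i y, 0 ≤ φ i y) ∧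
      (∀ y, ∑ i ∈ t, φ i y = 1) ∧ ∀ i y, φ i y ≠ 0 → dist y (d i) < 1 / ((k : ℝ) + 1) := by
    intro k
    have hk : (0 : ℝ) < 1 / ((k : ℝ) + 1) := by positivity
    obtain ⟨p, hp⟩ := PartitionOfUnity.exists_isSubordinate (isClosed_univ (X := 𝕏))
      (fun i : ℕ ↦ Metric.ball (d i) (1 / ((k : ℝ) + 1))) (fun i ↦ Metric.isOpen_ball)
      (fun y _ ↦ by
        obtain ⟨i, hi⟩ := hd.exists_dist_lt y hk
        exact Set.mem_iUnion.2 ⟨i, hi⟩)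
    have hfin := p.locallyFinite.finite_nonempty_of_compact
    refine ⟨hfin.toFinset, p, fun i y ↦ p.nonneg i y, fun y ↦ ?_, fun i y hy ↦ ?_⟩
    · rw [← p.sum_eq_one (Set.mem_univ y)]
      refine (finsum_eq_sum_of_support_subset _ fun i hi ↦ ?_).symm
      exact Finset.mem_coe.2 (hfin.mem_toFinset.2 ⟨y, hi⟩)
    · exact hp i (subset_tsupport _ hy)
  choose t φ h0 h1 h2 using key
  refine ⟨t, φ, h0, h1, fun f ↦ ?_⟩
  rw [Metric.tendsto_atTop]
  intro ε hε
  obtain ⟨δ, hδ, hf⟩ := Metric.uniformContinuous_iff.1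
    (CompactSpace.uniformContinuous_of_continuous f.continuous) (ε / 2) (half_pos hε)
  obtain ⟨N, hN⟩ := exists_nat_one_div_lt hδ
  refine ⟨N, fun k hk ↦ ?_⟩
  refine lt_of_le_of_lt ((ContinuousMap.dist_le (half_pos hε).le).2 fun y ↦ ?_) (half_lt_self hε)
  have hkδ : 1 / ((k : ℝ) + 1) < δ := (one_div_le_one_div_of_le (by positivity)
    (by exact_mod_cast Nat.succ_le_succ hk)).trans_lt hN
  have e : (∑ i ∈ t k, f (d i) • φ k i) y - f y = ∑ i ∈ t k, (f (d i) - f y) * φ k i y := by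
    simp only [ContinuousMap.sum_apply, ContinuousMap.smul_apply, smul_eq_mul, sub_mul,
      Finset.sum_sub_distrib, ← Finset.mul_sum, h1, mul_one]
  rw [Real.dist_eq, e]
  calc |∑ i ∈ t k, (f (d i) - f y) * φ k i y|
      ≤ ∑ i ∈ t k, |(f (d i) - f y) * φ k i y| := Finset.abs_sum_le_sum_abs _ _
    _ ≤ ∑ i ∈ t k, ε / 2 * φ k i y := by
        refine Finset.sum_le_sum fun i _ ↦ ?_
        rw [abs_mul, abs_of_nonneg (h0 k i y)]
        by_cases hz : φ k i y = 0
        · simp [hz]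
        · refine mul_le_mul_of_nonneg_right ?_ (h0 k i y)
          rw [← Real.dist_eq]
          exact (hf (by rw [dist_comm]; exact (h2 k i y hz).trans hkδ)).le
    _ = ε / 2 := by rw [← Finset.mul_sum, h1, mul_one]

/-- A random continuous function with measurable evaluations is Borel measurable. -/
theorem measurable_of_measurable_eval {𝕏 : Type*} [MetricSpace 𝕏] [CompactSpace 𝕏] [Nonempty 𝕏]
    {Ω : Type*} [MeasurableSpace Ω] {ξ : Ω → C(𝕏, ℝ)}
    (hξ : ∀ x, Measurable fun ω ↦ ξ ω x) : Measurable ξ := by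
  obtain ⟨t, φ, h⟩ := exists_interpolationScheme (TopologicalSpace.denseRange_denseSeq 𝕏)
  refine measurable_of_tendsto_metrizable (f := fun k ω ↦
    ∑ i ∈ t k, ξ ω (TopologicalSpace.denseSeq 𝕏 i) • φ k i) (fun k ↦ ?_)
    (tendsto_pi_nhds.2 fun ω ↦ h.tendsto (ξ ω))
  exact Finset.measurable_fun_sum _ fun i _ ↦ (hξ _).smul_const _

/-- The finite rational combination `∑ i, q i • δ_{d i}` of evaluation functionals. -/
noncomputable def ratEval (d : ℕ → 𝕏) (q : ℕ →₀ ℚ) : C(𝕏, ℝ) →L[ℝ] ℝ :=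
  ∑ i ∈ q.support, (q i : ℝ) • ContinuousMap.evalCLM ℝ (d i)

theorem ratEval_apply (d : ℕ → 𝕏) (q : ℕ →₀ ℚ) (f : C(𝕏, ℝ)) :
    ratEval d q f = ∑ i ∈ q.support, (q i : ℝ) * f (d i) := by
  simp [ratEval]

/-- Rational combinations of evaluations along a dense sequence are sequentially dense in the dual
of `C(𝕏, ℝ)` for pointwise convergence: interpolate, then round the coefficients `L (φ k i)`. -/
theorem exists_tendsto_ratEval {𝕏 : Type*} [MetricSpace 𝕏] [CompactSpace 𝕏] {d : ℕ → 𝕏}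
    (hd : DenseRange d) (L : StrongDual ℝ C(𝕏, ℝ)) :
    ∃ q : ℕ → ℕ →₀ ℚ, ∀ f, Tendsto (fun k ↦ ratEval d (q k) f) atTop (𝓝 (L f)) := by
  obtain ⟨t, φ, h⟩ := exists_interpolationScheme hd
  have hr : ∀ k i : ℕ, ∃ r : ℚ, |(r : ℝ) - L (φ k i)| < 1 / (((k : ℝ) + 1) * ((t k).card + 1)) := by
    intro k i
    obtain ⟨r, hr1, hr2⟩ := exists_rat_btwn (show L (φ k i) <
      L (φ k i) + 1 / (((k : ℝ) + 1) * ((t k).card + 1)) from lt_add_of_pos_right _ (by positivity))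
    exact ⟨r, by rw [abs_of_pos (sub_pos.2 hr1)]; linarith⟩
  choose r hr using hr
  classical
  refine ⟨fun k ↦ Finsupp.onFinset (t k) (fun i ↦ if i ∈ t k then r k i else 0)
    (fun i hi ↦ by by_contra hc; simp [hc] at hi), fun f ↦ ?_⟩
  have h1 : Tendsto (fun k ↦ L (∑ i ∈ t k, f (d i) • φ k i)) atTop (𝓝 (L f)) :=
    (L.continuous.tendsto f).comp (h.tendsto f)
  refine h1.congr_dist (squeeze_zero (fun _ ↦ dist_nonneg) (fun k ↦ ?_)
    (g := fun k : ℕ ↦ ‖f‖ * (1 / ((k : ℝ) + 1))) ?_)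
  swap
  · simpa using tendsto_one_div_add_atTop_nhds_zero_nat.const_mul ‖f‖
  have e : ratEval d (Finsupp.onFinset (t k) (fun i ↦ if i ∈ t k then r k i else 0)
      (fun i hi ↦ by by_contra hc; simp [hc] at hi)) f = ∑ i ∈ t k, (r k i : ℝ) * f (d i) := by
    rw [ratEval_apply, Finset.sum_subset (Finsupp.support_onFinset_subset)]
    · exact Finset.sum_congr rfl fun i hi ↦ by simp [hi]
    · intro i _ hi
      rw [Finsupp.notMem_support_iff.1 hi]; simp
  rw [e, dist_comm, Real.dist_eq, map_sum, ← Finset.sum_sub_distrib]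
  calc |∑ i ∈ t k, ((r k i : ℝ) * f (d i) - L (f (d i) • φ k i))|
      ≤ ∑ i ∈ t k, |(r k i : ℝ) * f (d i) - L (f (d i) • φ k i)| := Finset.abs_sum_le_sum_abs _ _
    _ ≤ ∑ i ∈ t k, 1 / (((k : ℝ) + 1) * ((t k).card + 1)) * ‖f‖ := by
        refine Finset.sum_le_sum fun i _ ↦ ?_
        rw [map_smul, smul_eq_mul, mul_comm (f (d i)), ← sub_mul, abs_mul]
        exact mul_le_mul (hr k i).le (f.norm_coe_le_norm _) (abs_nonneg _) (by positivity)
    _ ≤ ‖f‖ * (1 / ((k : ℝ) + 1)) := by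
        rw [Finset.sum_const, nsmul_eq_mul, ← mul_assoc, mul_comm ‖f‖]
        refine mul_le_mul_of_nonneg_right ?_ (norm_nonneg f)
        rw [mul_one_div, div_le_div_iff₀ (by positivity) (by positivity)]
        nlinarith [show (0 : ℝ) ≤ k from k.cast_nonneg]

end Interpolation

/-! ### Limits of Gaussian laws -/

section GaussianLimits

/-- A probability measure on `ℝ` whose characteristic function has the Gaussian form at rational
points is Gaussian. -/
theorem isGaussian_of_charFun_rat {ρ : Measure ℝ} [IsProbabilityMeasure ρ] {m v : ℝ}
    (h : ∀ t : ℚ, charFun ρ t = Complex.exp (t * m * Complex.I - v * (t : ℂ) ^ 2 / 2)) :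
    IsGaussian ρ := by
  have h' : ∀ t : ℝ, charFun ρ t = Complex.exp (t * m * Complex.I - v * (t : ℂ) ^ 2 / 2) := by
    refine fun t ↦ congrFun (Continuous.ext_on Rat.denseRange_cast (f := charFun ρ)
      (g := fun t : ℝ ↦ Complex.exp (t * m * Complex.I - v * (t : ℂ) ^ 2 / 2))
      (by fun_prop) (by fun_prop) ?_) t
    rintro _ ⟨q, rfl⟩
    simpa using h q
  have hv : 0 ≤ v := by
    have h1 := norm_charFun_le_one (μ := ρ) (1 : ℝ)
    rw [h', Complex.norm_exp] at h1
    have := Real.exp_le_one_iff.1 h1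
    simp at this
    linarith
  have : ρ = gaussianReal m v.toNNReal := by
    refine Measure.ext_of_charFun (funext fun t ↦ ?_)
    rw [h', charFun_gaussianReal]
    simp [hv]
  rw [this]
  infer_instance

variable {Ω : Type*} [MeasurableSpace Ω] {ρ : Measure Ω}

/-- A sequence of random variables that converges everywhere is bounded by a constant with
probability more than `1 / 2`. -/
theorem exists_forall_abs_le_of_tendsto [IsProbabilityMeasure ρ] {Y : ℕ → Ω → ℝ} {Y' : Ω → ℝ}
    (hm : ∀ n, AEMeasurable (Y n) ρ) (h : ∀ ω, Tendsto (fun n ↦ Y n ω) atTop (𝓝 (Y' ω))) :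
    ∃ M : ℝ, ρ {ω | ∃ n, M < |Y n ω|} < 1 / 2 := by
  have hlim : Tendsto (fun k : ℕ ↦ ρ {ω | ∃ n, (k : ℝ) < |Y n ω|}) atTop
      (𝓝 (ρ (⋂ k : ℕ, {ω | ∃ n, (k : ℝ) < |Y n ω|}))) := by
    refine tendsto_measure_iInter_atTop (fun k ↦ ?_) (fun a b hab ω ⟨n, hn⟩ ↦
      ⟨n, lt_of_le_of_lt (by exact_mod_cast hab) hn⟩) ⟨0, measure_ne_top _ _⟩
    have : {ω | ∃ n, (k : ℝ) < |Y n ω|} = ⋃ n, {ω | (k : ℝ) < |Y n ω|} := by ext; simp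
    rw [this]
    exact NullMeasurableSet.iUnion fun n ↦
      nullMeasurableSet_lt aemeasurable_const (measurable_norm.comp_aemeasurable (hm n))
  have hempty : (⋂ k : ℕ, {ω | ∃ n, (k : ℝ) < |Y n ω|}) = ∅ := by
    refine Set.eq_empty_iff_forall_notMem.2 fun ω hω ↦ ?_
    obtain ⟨C, hC⟩ := (h ω).abs.bddAbove_range
    obtain ⟨k, hk⟩ := exists_nat_gt C
    obtain ⟨n, hn⟩ := Set.mem_iInter.1 hω k
    linarith [hC ⟨n, rfl⟩]
  rw [hempty, measure_empty] at hlim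
  obtain ⟨k, hk⟩ := (hlim.eventually_lt_const (u := 1 / 2) (by simp)).exists
  exact ⟨k, hk⟩

/-- An everywhere limit of real Gaussian random variables is Gaussian: the variances converge
because the moduli of the characteristic functions do, the means are bounded by Chebyshev's
inequality, and along a subsequence the characteristic functions converge to a Gaussian one. -/
theorem hasGaussianLaw_of_tendsto {Y : ℕ → Ω → ℝ} {Y' : Ω → ℝ}
    (hY : ∀ n, HasGaussianLaw (Y n) ρ) (h : ∀ ω, Tendsto (fun n ↦ Y n ω) atTop (𝓝 (Y' ω))) :
    HasGaussianLaw Y' ρ := by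
  have := (hY 0).isProbabilityMeasure
  have hY'm : AEMeasurable Y' ρ := aemeasurable_of_tendsto_metrizable_ae atTop
    (fun n ↦ (hY n).aemeasurable) (ae_of_all _ h)
  have : IsProbabilityMeasure (ρ.map Y') := Measure.isProbabilityMeasure_map hY'm
  have hcf : ∀ n (t : ℝ), charFun (ρ.map (Y n)) t =
      Complex.exp (t * (ρ[Y n] : ℝ) * Complex.I - (Var[Y n; ρ] : ℝ) * (t : ℂ) ^ 2 / 2) := by
    intro n t
    rw [(hY n).map_eq_gaussianReal, charFun_gaussianReal]
    simp [variance_nonneg]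
  have hlim : ∀ t : ℝ, Tendsto (fun n ↦ charFun (ρ.map (Y n)) t) atTop
      (𝓝 (charFun (ρ.map Y') t)) := by
    intro t
    simp only [charFun_apply]
    rw [integral_map hY'm (by fun_prop)]
    have : ∀ n, ∫ x, Complex.exp (inner ℝ x t * Complex.I) ∂(ρ.map (Y n)) =
        ∫ ω, Complex.exp (inner ℝ (Y n ω) t * Complex.I) ∂ρ := fun n ↦
      integral_map (hY n).aemeasurable (by fun_prop)
    simp only [this]
    refine tendsto_integral_of_dominated_convergence (fun _ ↦ 1) (fun n ↦ ?_)
      (integrable_const _) (fun n ↦ ae_of_all _ fun ω ↦ ?_) (ae_of_all _ fun ω ↦ ?_)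
    · exact (by fun_prop : Continuous fun x : ℝ ↦
        Complex.exp (inner ℝ x t * Complex.I)).measurable.comp_aemeasurable
          (hY n).aemeasurable |>.aestronglyMeasurable
    · rw [Complex.norm_exp_ofReal_mul_I]
    · exact ((by fun_prop : Continuous fun x : ℝ ↦
        Complex.exp (inner ℝ x t * Complex.I)).tendsto _).comp (h ω)
  -- a point where the limiting characteristic function does not vanish
  obtain ⟨t₀, ht₀, hne⟩ : ∃ t₀ : ℝ, t₀ ≠ 0 ∧ charFun (ρ.map Y') t₀ ≠ 0 := by
    have hc : ContinuousAt (charFun (ρ.map Y')) (0 : ℝ) := by fun_prop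
    have h0 : charFun (ρ.map Y') (0 : ℝ) ≠ 0 := by simp
    have h1 : ∀ᶠ t in 𝓝[≠] (0 : ℝ), charFun (ρ.map Y') t ≠ 0 :=
      (hc.eventually_ne h0).filter_mono nhdsWithin_le_nhds
    obtain ⟨t, h2, h3⟩ := (h1.and self_mem_nhdsWithin).exists
    exact ⟨t, h3, h2⟩
  have hvar : Tendsto (fun n ↦ Var[Y n; ρ]) atTop
      (𝓝 (-2 * Real.log ‖charFun (ρ.map Y') t₀‖ / t₀ ^ 2)) := by
    have h1 := (((hlim t₀).norm.log (norm_ne_zero_iff.2 hne)).const_mul (-2)).div_const (t₀ ^ 2)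
    refine h1.congr fun n ↦ ?_
    rw [hcf, Complex.norm_exp, Real.log_exp]
    have : ((t₀ * (ρ[Y n] : ℝ) * Complex.I - (Var[Y n; ρ] : ℝ) * (t₀ : ℂ) ^ 2 / 2 : ℂ)).re =
        - (Var[Y n; ρ] * t₀ ^ 2 / 2) := by
      rw [show (t₀ * (ρ[Y n] : ℝ) * Complex.I - (Var[Y n; ρ] : ℝ) * (t₀ : ℂ) ^ 2 / 2 : ℂ) =
        ((t₀ * ρ[Y n] : ℝ) : ℂ) * Complex.I + ((- (Var[Y n; ρ] * t₀ ^ 2 / 2) : ℝ) : ℂ) by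
          push_cast; ring]
      rw [Complex.add_re, Complex.re_ofReal_mul, Complex.I_re, mul_zero, zero_add, Complex.ofReal_re]
    rw [this]
    field_simp
  obtain ⟨V, hV⟩ := hvar.bddAbove_range
  have hV' : ∀ n, Var[Y n; ρ] ≤ V := fun n ↦ hV ⟨n, rfl⟩
  have hV0 : 0 ≤ V := (variance_nonneg _ _).trans (hV' 0)
  obtain ⟨M, hM⟩ := exists_forall_abs_le_of_tendsto (fun n ↦ (hY n).aemeasurable) h
  -- the event that all `Y n` are bounded by `M` meets the event that `Y n` is close to its mean
  have hmean : ∀ n, |ρ[Y n]| ≤ M + (2 * V + 2) := by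
    intro n
    have hR : (0 : ℝ) < 2 * V + 2 := by linarith
    have hcheb := meas_ge_le_variance_div_sq (hY n).memLp_two hR
    have hlt : ENNReal.ofReal (Var[Y n; ρ] / (2 * V + 2) ^ 2) ≤ 1 / 2 := by
      rw [show (1 / 2 : ENNReal) = ENNReal.ofReal (1 / 2) by
        rw [ENNReal.ofReal_div_of_pos (by norm_num)]; simp]
      refine ENNReal.ofReal_le_ofReal ?_
      rw [div_le_div_iff₀ (by positivity) (by norm_num)]
      nlinarith [hV' n]
    have hsum : ρ ({ω | ∃ n, M < |Y n ω|} ∪ {ω | 2 * V + 2 ≤ |Y n ω - ρ[Y n]|}) < 1 := by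
      refine (measure_union_le _ _).trans_lt ?_
      calc _ < (1 / 2 : ENNReal) + 1 / 2 :=
            ENNReal.add_lt_add_of_lt_of_le (by simp) hM (hcheb.trans hlt)
        _ = 1 := ENNReal.add_halves 1
    obtain ⟨ω, hω⟩ : ∃ ω, ω ∉ ({ω | ∃ n, M < |Y n ω|} ∪ {ω | 2 * V + 2 ≤ |Y n ω - ρ[Y n]|}) := by
      by_contra! hc
      rw [Set.eq_univ_of_forall hc, measure_univ] at hsum
      exact lt_irrefl _ hsum
    simp only [Set.mem_union, Set.mem_ofPred_eq, not_or, not_exists, not_lt, not_le] at hω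
    have h1 := hω.1 n
    have h2 := hω.2
    have h3 : |ρ[Y n]| ≤ |Y n ω| + |Y n ω - ρ[Y n]| := by
      calc |ρ[Y n]| = |Y n ω - (Y n ω - ρ[Y n])| := by rw [sub_sub_cancel]
        _ ≤ _ := abs_sub _ _
    linarith
  obtain ⟨m, -, s, hs, hm⟩ := tendsto_subseq_of_bounded (x := fun n ↦ ρ[Y n])
    (Metric.isBounded_Icc (-(M + (2 * V + 2))) (M + (2 * V + 2))) (fun n ↦ abs_le.1 (hmean n))
  have hgauss : IsGaussian (ρ.map Y') := by
    refine isGaussian_of_charFun_rat (m := m)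
      (v := -2 * Real.log ‖charFun (ρ.map Y') t₀‖ / t₀ ^ 2) fun t ↦ ?_
    refine tendsto_nhds_unique ((hlim t).comp hs.tendsto_atTop) ?_
    have hv := hvar.comp hs.tendsto_atTop
    have e : (fun n ↦ charFun (ρ.map (Y n)) (t : ℝ)) ∘ s = fun n ↦
        Complex.exp (t * ((ρ[Y (s n)] : ℝ) : ℂ) * Complex.I -
          ((Var[Y (s n); ρ] : ℝ) : ℂ) * (t : ℂ) ^ 2 / 2) := by
      funext n
      simp [hcf]
    rw [e]
    have h1 := (Complex.continuous_ofReal.tendsto _).comp hm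
    have h2 := (Complex.continuous_ofReal.tendsto _).comp hv
    exact (Complex.continuous_exp.tendsto _).comp
      (((h1.const_mul (t : ℂ)).mul_const Complex.I).sub ((h2.mul_const _).div_const 2))
  exact ⟨hgauss⟩

end GaussianLimits

section ContinuousFunctions

variable {𝕏 : Type*} [MetricSpace 𝕏] [CompactSpace 𝕏]

/-- A probability measure on `C(𝕏, ℝ)` under which rational combinations of evaluations along a
dense sequence are Gaussian is Gaussian. -/
theorem isGaussian_of_ratEval {d : ℕ → 𝕏} (hd : DenseRange d) {ν : Measure C(𝕏, ℝ)}
    (h : ∀ q, IsGaussian (ν.map (ratEval d q))) : IsGaussian ν := by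
  refine isGaussian_of_isGaussian_map fun L ↦ ?_
  obtain ⟨q, hq⟩ := exists_tendsto_ratEval hd L
  exact (hasGaussianLaw_of_tendsto (fun n ↦ ⟨h (q n)⟩) hq).isGaussian_map

/-- A Gaussian process with continuous paths on a compact metric space, seen as a random element of
`C(𝕏, ℝ)`, has a Gaussian law. -/
theorem isGaussian_map_of_isGaussianProcess [Nonempty 𝕏] {Ω : Type*} [MeasurableSpace Ω]
    {μ : Measure Ω} {ξ : Ω → C(𝕏, ℝ)} (hξ_meas : Measurable ξ)
    (hξ : IsGaussianProcess (fun (x : 𝕏) (ω : Ω) ↦ ξ ω x) μ) : IsGaussian (μ.map ξ) := by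
  refine isGaussian_of_ratEval (TopologicalSpace.denseRange_denseSeq 𝕏) fun q ↦ ?_
  rw [Measure.map_map (ContinuousLinearMap.measurable _) hξ_meas]
  have hξ' := (hξ.comp_right (TopologicalSpace.denseSeq 𝕏)).smul (fun i ↦ (q i : ℝ))
  have := hξ'.hasGaussianLaw_fun_sum (I := q.support)
  refine HasGaussianLaw.isGaussian_map (this.congr (ae_of_all _ fun ω ↦ ?_))
  simp [ratEval_apply]

end ContinuousFunctions

/-! ### Conditional laws and joint laws -/

section ConditionalLaws

variable {α β E : Type*} [MeasurableSpace α] [mβ : MeasurableSpace β] [MeasurableSpace E]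
  {μ : Measure α} [IsProbabilityMeasure μ] {X : α → β} {Y : α → E}

/-- A Markov kernel giving the conditional probabilities of all events `Y ∈ A` given `X`
disintegrates the joint law of `(X, Y)`. -/
theorem map_prodMk_eq_compProd_of_ae_eq_condExp (hX : Measurable X) (hY : Measurable Y)
    {κ : Kernel β E} [IsMarkovKernel κ]
    (h : ∀ A, MeasurableSet A → (fun a ↦ (κ (X a)).real A) =ᵐ[μ] μ⟦Y ⁻¹' A | mβ.comap X⟧) :
    μ.map (fun a ↦ (X a, Y a)) = μ.map X ⊗ₘ κ := by
  have : IsProbabilityMeasure (μ.map (fun a ↦ (X a, Y a))) :=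
    Measure.isProbabilityMeasure_map (hX.prodMk hY).aemeasurable
  refine Measure.ext_prod fun {s A} hs hA ↦ ?_
  have hκ : Measurable fun a ↦ κ (X a) A := (κ.measurable_coe hA).comp hX
  rw [Measure.compProd_apply_prod hs hA, setLIntegral_map hs (κ.measurable_coe hA) hX,
    Measure.map_apply (hX.prodMk hY) (hs.prod hA), Set.mk_preimage_prod]
  have h1 : ∫ a in X ⁻¹' s, (κ (X a)).real A ∂μ = μ.real (X ⁻¹' s ∩ Y ⁻¹' A) := by
    rw [setIntegral_congr_ae (g := μ⟦Y ⁻¹' A | mβ.comap X⟧) (hX hs)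
        ((h A hA).mono fun _ hx _ ↦ hx),
      setIntegral_condExp hX.comap_le ((integrable_const _).indicator (hY hA)) ⟨s, hs, rfl⟩,
      setIntegral_indicator (hY hA)]
    simp
  have h2 := integral_toReal (μ := μ.restrict (X ⁻¹' s)) hκ.aemeasurable
    (ae_of_all _ fun a ↦ measure_lt_top (κ (X a)) A)
  simp only [Measure.real] at h1
  rw [h1] at h2
  refine ((ENNReal.toReal_eq_toReal_iff' (measure_ne_top _ _) ?_).1 h2)
  refine ((lintegral_mono fun a ↦ prob_le_one).trans_lt ?_).ne
  simp

variable [StandardBorelSpace E] [Nonempty E]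

theorem ae_eq_condExp_of_map_prodMk_eq_compProd (hX : Measurable X) (hY : Measurable Y)
    {κ : Kernel β E} [IsMarkovKernel κ] (h : μ.map (fun a ↦ (X a, Y a)) = μ.map X ⊗ₘ κ)
    {A : Set E} (hA : MeasurableSet A) :
    (fun a ↦ (κ (X a)).real A) =ᵐ[μ] μ⟦Y ⁻¹' A | mβ.comap X⟧ := by
  refine Filter.EventuallyEq.trans ?_ (condDistrib_ae_eq_condExp hX hY hA)
  filter_upwards [ae_of_ae_map hX.aemeasurable
    (condDistrib_ae_eq_of_measure_eq_compProd X hY.aemeasurable h)] with a ha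
  rw [ha]

theorem integral_ae_eq_condExp_of_map_prodMk_eq_compProd (hX : Measurable X) (hY : Measurable Y)
    {κ : Kernel β E} [IsMarkovKernel κ] (h : μ.map (fun a ↦ (X a, Y a)) = μ.map X ⊗ₘ κ)
    {g : E → ℝ} (hg : StronglyMeasurable g) (hgY : Integrable (fun a ↦ g (Y a)) μ) :
    (fun a ↦ ∫ f, g f ∂(κ (X a))) =ᵐ[μ] μ[fun a ↦ g (Y a) | mβ.comap X] := by
  refine Filter.EventuallyEq.trans ?_ (condExp_ae_eq_integral_condDistrib hX hY.aemeasurable hg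
    hgY).symm
  filter_upwards [ae_of_ae_map hX.aemeasurable
    (condDistrib_ae_eq_of_measure_eq_compProd X hY.aemeasurable h)] with a ha
  rw [ha]

end ConditionalLaws

/-! ### Conditioning a Gaussian measure on a noisy linear observation -/

section Matheron

variable {E : Type*} [NormedAddCommGroup E] [NormedSpace ℝ E]

/-- The observation `ℓ f + σ u` of a vector `f` through the functional `ℓ`, with noise `u` scaled
by `σ`, as a functional of `(f, u)`. -/
noncomputable def noisyObs (ℓ : StrongDual ℝ E) (σ : ℝ) : StrongDual ℝ (E × ℝ) :=
  ℓ.comp (ContinuousLinearMap.fst ℝ E ℝ) + σ • ContinuousLinearMap.snd ℝ E ℝ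

theorem noisyObs_apply (ℓ : StrongDual ℝ E) (σ : ℝ) (p : E × ℝ) :
    noisyObs ℓ σ p = ℓ p.1 + σ * p.2 := by
  simp [noisyObs]

/-- The residual `f - (ℓ f + σ u) • c` of the regression of `f` on the observation, for a
coefficient `c`. -/
noncomputable def residual (ℓ : StrongDual ℝ E) (σ : ℝ) (c : E) : E × ℝ →L[ℝ] E :=
  ContinuousLinearMap.fst ℝ E ℝ - (noisyObs ℓ σ).smulRight c

theorem residual_apply (ℓ : StrongDual ℝ E) (σ : ℝ) (c : E) (p : E × ℝ) :
    residual ℓ σ c p = p.1 - (ℓ p.1 + σ * p.2) • c := by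
  simp [residual, noisyObs_apply]

variable [MeasurableSpace E]

/-- The regression coefficient of `f` on `ℓ f + σ u`, where `f` has law `ν` and `u` is an
independent standard Gaussian variable. It is `0` if the observation has zero variance. -/
noncomputable def gain (ν : Measure E) (ℓ : StrongDual ℝ E) (σ : ℝ) : E :=
  (Var[ℓ; ν] + σ ^ 2)⁻¹ • ∫ f, (ℓ f - ∫ g, ℓ g ∂ν) • f ∂ν

variable [BorelSpace E] (ν : Measure E) [IsGaussian ν] (ℓ : StrongDual ℝ E) (σ : ℝ)

/-- The law of the residual shifted by `z • gain` is Gaussian. -/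
theorem isGaussian_map_residual_add (c x : E) :
    IsGaussian ((ν.prod (gaussianReal 0 1)).map fun p ↦ residual ℓ σ c p + x) := by
  have : (ν.prod (gaussianReal 0 1)).map (fun p ↦ residual ℓ σ c p + x) =
      ((ν.prod (gaussianReal 0 1)).map (residual ℓ σ c)).map (fun f ↦ f + x) := by
    rw [Measure.map_map (by fun_prop) (by fun_prop)]
    rfl
  rw [this]
  infer_instance

variable [CompleteSpace E] [SecondCountableTopology E]

/-- The normal equation defining the regression coefficient. It also holds if the observation has
zero variance, because the covariance then vanishes. -/
theorem gain_spec
    (L : StrongDual ℝ E) : (Var[ℓ; ν] + σ ^ 2) * L (gain ν ℓ σ) = cov[L, ℓ; ν] := by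
  have hL := IsGaussian.memLp_dual ν L 2 (by simp)
  have hℓ := IsGaussian.memLp_dual ν ℓ 2 (by simp)
  have hℓ' : MemLp (fun f ↦ ℓ f - ∫ g, ℓ g ∂ν) 2 ν := hℓ.sub (memLp_const _)
  rcases (add_nonneg (variance_nonneg ℓ ν) (sq_nonneg σ)).eq_or_lt with h0 | h0
  · have hv : Var[ℓ; ν] = 0 := by nlinarith [variance_nonneg ℓ ν, sq_nonneg σ]
    rw [← h0, zero_mul, covariance]
    refine (integral_eq_zero_of_ae ?_).symm
    filter_upwards [ae_eq_integral_of_variance_eq_zero hℓ hv] with f hf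
    simp [hf]
  · have hint : Integrable (fun f ↦ (ℓ f - ∫ g, ℓ g ∂ν) • f) ν :=
      (IsGaussian.memLp_two_id (μ := ν)).smul (r := 1) hℓ' |> memLp_one_iff_integrable.1
    rw [gain, map_smul, smul_eq_mul, mul_inv_cancel_left₀ h0.ne',
      ← ContinuousLinearMap.integral_comp_comm _ hint, covariance_eq_sub hL hℓ]
    simp only [map_smul, smul_eq_mul, sub_mul, Pi.mul_apply]
    rw [integral_sub, integral_const_mul]
    · simp only [mul_comm]
    · exact hℓ.integrable_mul hL
    · exact (hL.integrable (by simp)).const_mul _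

/-- The residual and the observation are uncorrelated and jointly Gaussian, hence independent. -/
theorem indepFun_residual_noisyObs :
    IndepFun (residual ℓ σ (gain ν ℓ σ)) (noisyObs ℓ σ) (ν.prod (gaussianReal 0 1)) := by
  set π := ν.prod (gaussianReal 0 1) with hπ
  refine HasGaussianLaw.indepFun_of_covariance_strongDual (P := π)
    (((IsGaussian.hasGaussianLaw_id (μ := π)).map
      ((residual ℓ σ (gain ν ℓ σ)).prod (noisyObs ℓ σ))).congr (ae_of_all _ fun p ↦ rfl))
    fun L₁ L₂ ↦ ?_
  have hmem : ∀ L : StrongDual ℝ (E × ℝ), MemLp L 2 π := fun L ↦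
    IsGaussian.memLp_dual π L 2 (by simp)
  have hmemE : ∀ L : StrongDual ℝ E, MemLp L 2 ν := fun L ↦ IsGaussian.memLp_dual ν L 2 (by simp)
  have hid : MemLp (fun u : ℝ ↦ u) 2 (gaussianReal 0 1) := IsGaussian.memLp_two_id
  have hfst : ∀ L : StrongDual ℝ E, MemLp (fun p : E × ℝ ↦ L p.1) 2 π := fun L ↦
    hmem (L.comp (ContinuousLinearMap.fst ℝ E ℝ))
  have hsnd : MemLp (fun p : E × ℝ ↦ σ * p.2) 2 π :=
    (hmem (ContinuousLinearMap.snd ℝ E ℝ)).const_mul σ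
  -- covariance of the observation with a functional of `f`
  have hcov : ∀ L : StrongDual ℝ E,
      cov[fun p : E × ℝ ↦ L p.1, noisyObs ℓ σ; π] = cov[L, ℓ; ν] := by
    intro L
    have e : (noisyObs ℓ σ : E × ℝ → ℝ) = (fun p ↦ ℓ p.1) + fun p ↦ σ * p.2 := by
      ext p; simp [noisyObs_apply]
    rw [e, covariance_add_right (hfst L) (hfst ℓ) hsnd, covariance_const_mul_right, hπ,
      covariance_fst_snd_prod (hmemE L) hid, mul_zero, add_zero]
    have hπν : π.map Prod.fst = ν := by rw [hπ, Measure.map_fst_prod]; simp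
    conv_rhs => rw [← hπν]
    rw [covariance_map (by fun_prop) (by fun_prop) (by fun_prop)]
    rfl
  have hvar : Var[noisyObs ℓ σ; π] = Var[ℓ; ν] + σ ^ 2 := by
    have e : (noisyObs ℓ σ : E × ℝ → ℝ) = fun p ↦ ℓ p.1 + σ * p.2 := by
      ext p; simp [noisyObs_apply]
    rw [e, hπ, variance_add_prod (hmemE ℓ) (hid.const_mul σ), variance_const_mul]
    simp
  have e1 : L₁ ∘ residual ℓ σ (gain ν ℓ σ) =
      (fun p ↦ L₁ p.1) - fun p ↦ L₁ (gain ν ℓ σ) * noisyObs ℓ σ p := by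
    ext p; simp [residual_apply, noisyObs_apply, mul_comm]
  have e2 : L₂ ∘ noisyObs ℓ σ = fun p ↦ L₂ 1 * noisyObs ℓ σ p := by
    ext p
    rw [Function.comp_apply, ← mul_one (noisyObs ℓ σ p), ← smul_eq_mul, map_smul]
    simp [mul_comm]
  rw [e1, e2, covariance_const_mul_right, covariance_sub_left (hfst L₁) ((hmem _).const_mul _)
    (hmem _), covariance_const_mul_left, hcov, covariance_self (by fun_prop), hvar,
    ← gain_spec ν ℓ σ L₁]
  ring

/-- **Matheron's rule**: conditionally on the observation `z`, the vector `f` is distributed as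
the residual of an independent copy plus `z • gain`. -/
theorem lintegral_noisyObs_prodMk {ψ : ℝ × E → ENNReal} (hψ : Measurable ψ) :
    ∫⁻ p, ψ (noisyObs ℓ σ p, p.1) ∂(ν.prod (gaussianReal 0 1)) =
      ∫⁻ p, ∫⁻ p', ψ (noisyObs ℓ σ p,
        residual ℓ σ (gain ν ℓ σ) p' + noisyObs ℓ σ p • gain ν ℓ σ)
          ∂(ν.prod (gaussianReal 0 1)) ∂(ν.prod (gaussianReal 0 1)) := by
  set π := ν.prod (gaussianReal 0 1)
  have hind := (indepFun_iff_map_prod_eq_prod_map_map (by fun_prop) (by fun_prop)).1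
    (indepFun_residual_noisyObs ν ℓ σ).symm
  have hm : Measurable fun q : ℝ × E ↦ ψ (q.1, q.2 + q.1 • gain ν ℓ σ) := by fun_prop
  calc ∫⁻ p, ψ (noisyObs ℓ σ p, p.1) ∂π
      = ∫⁻ p, ψ (noisyObs ℓ σ p,
          residual ℓ σ (gain ν ℓ σ) p + noisyObs ℓ σ p • gain ν ℓ σ) ∂π := by
        simp [residual_apply, noisyObs_apply]
    _ = ∫⁻ q, ψ (q.1, q.2 + q.1 • gain ν ℓ σ)
          ∂(π.map fun p ↦ (noisyObs ℓ σ p, residual ℓ σ (gain ν ℓ σ) p)) := by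
        rw [lintegral_map hm (by fun_prop)]
    _ = _ := by
        rw [hind, lintegral_prod _ hm.aemeasurable, lintegral_map (by fun_prop) (by fun_prop)]
        refine lintegral_congr fun p ↦ ?_
        rw [lintegral_map (by fun_prop) (by fun_prop)]

end Matheron

section Noise

variable {α β E : Type*} [MeasurableSpace α] [MeasurableSpace β] [MeasurableSpace E]
  {μ : Measure α} [IsProbabilityMeasure μ] {κ : Kernel β E} [IsMarkovKernel κ]
  {X : α → β} {Y : α → E} {u : α → ℝ}

/-- Joint integrals of `X`, `Y` and a noise `u` independent of `(X, Y)`. -/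
theorem lintegral_prodMk_noise (hX : Measurable X) (hY : Measurable Y) (hu : Measurable u)
    (hXY : μ.map (fun a ↦ (X a, Y a)) = μ.map X ⊗ₘ κ) (hu_law : μ.map u = gaussianReal 0 1)
    (hind : IndepFun (fun a ↦ (X a, Y a)) u μ) {F : β × E × ℝ → ENNReal} (hF : Measurable F) :
    ∫⁻ a, F (X a, Y a, u a) ∂μ =
      ∫⁻ a, ∫⁻ p, F (X a, p) ∂((κ (X a)).prod (gaussianReal 0 1)) ∂μ := by
  have h1 := (indepFun_iff_map_prod_eq_prod_map_map (hX.prodMk hY).aemeasurable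
    hu.aemeasurable).1 hind
  have : IsProbabilityMeasure (μ.map X) := Measure.isProbabilityMeasure_map hX.aemeasurable
  have hF1 : Measurable fun q : (β × E) × ℝ ↦ F (q.1.1, q.1.2, q.2) := by fun_prop
  have hF2 : Measurable fun q : β × E ↦ ∫⁻ v, F (q.1, q.2, v) ∂(gaussianReal 0 1) :=
    hF1.lintegral_prod_right'
  have hF3 : Measurable fun b ↦ ∫⁻ f, ∫⁻ v, F (b, f, v) ∂(gaussianReal 0 1) ∂(κ b) :=
    hF2.lintegral_kernel_prod_right'
  calc ∫⁻ a, F (X a, Y a, u a) ∂μ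
      = ∫⁻ q, F (q.1.1, q.1.2, q.2) ∂(μ.map fun a ↦ ((X a, Y a), u a)) := by
        rw [lintegral_map hF1 ((hX.prodMk hY).prodMk hu)]
    _ = ∫⁻ b, ∫⁻ f, ∫⁻ v, F (b, f, v) ∂(gaussianReal 0 1) ∂(κ b) ∂(μ.map X) := by
        rw [h1, hXY, hu_law, lintegral_prod _ hF1.aemeasurable, Measure.lintegral_compProd hF2]
    _ = ∫⁻ a, ∫⁻ f, ∫⁻ v, F (X a, f, v) ∂(gaussianReal 0 1) ∂(κ (X a)) ∂μ := by
        rw [lintegral_map hF3 hX]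
    _ = _ := by
        refine lintegral_congr fun a ↦ ?_
        exact (lintegral_prod (fun p ↦ F (X a, p))
          (hF.comp measurable_prodMk_left).aemeasurable).symm

end Noise

section Update

variable {E : Type*} [NormedAddCommGroup E] [NormedSpace ℝ E] [MeasurableSpace E]

/-- The conditional law of `f` given that `ℓ f + σ u = z`, where `f` has the Gaussian law `ν` and
`u` is an independent standard Gaussian variable. -/
noncomputable def updatedLaw (ν : Measure E) (ℓ : StrongDual ℝ E) (σ z : ℝ) : Measure E :=
  (ν.prod (gaussianReal 0 1)).map fun p ↦ residual ℓ σ (gain ν ℓ σ) p + z • gain ν ℓ σ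

variable {β : Type*} [MeasurableSpace β] [BorelSpace E]
  [SecondCountableTopology E]
  {κ : Kernel β E} [IsMarkovKernel κ] {ℓ : β → StrongDual ℝ E} {σ : β → ℝ}

theorem measurable_gain (hℓ : Measurable fun p : β × E ↦ ℓ p.1 p.2) (hσ : Measurable σ) :
    Measurable fun b ↦ gain (κ b) (ℓ b) (σ b) := by
  have hm : Measurable fun b ↦ ∫ g, ℓ b g ∂(κ b) :=
    (StronglyMeasurable.integral_kernel_prod_right (κ := κ) (f := fun b g ↦ ℓ b g)
      hℓ.stronglyMeasurable).measurable
  have hc : Measurable fun p : β × E ↦ ℓ p.1 p.2 - ∫ g, ℓ p.1 g ∂(κ p.1) :=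
    hℓ.sub (hm.comp measurable_fst)
  have hv : Measurable fun b ↦ Var[ℓ b; κ b] := by
    have e : ∀ b, Var[ℓ b; κ b] = ∫ f, (ℓ b f - ∫ g, ℓ b g ∂(κ b)) ^ 2 ∂(κ b) := fun b ↦
      variance_eq_integral (by fun_prop)
    simp only [e]
    exact (StronglyMeasurable.integral_kernel_prod_right (κ := κ)
      (f := fun b f ↦ (ℓ b f - ∫ g, ℓ b g ∂(κ b)) ^ 2)
      (hc.pow_const 2).stronglyMeasurable).measurable
  have hi : Measurable fun b ↦ ∫ f, (ℓ b f - ∫ g, ℓ b g ∂(κ b)) • f ∂(κ b) :=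
    (StronglyMeasurable.integral_kernel_prod_right (κ := κ)
      (f := fun b f ↦ (ℓ b f - ∫ g, ℓ b g ∂(κ b)) • f)
      (hc.smul measurable_snd).stronglyMeasurable).measurable
  exact ((hv.add (hσ.pow_const 2)).inv).smul hi

theorem measurable_residual_add (hℓ : Measurable fun p : β × E ↦ ℓ p.1 p.2) (hσ : Measurable σ) :
    Measurable fun q : (β × ℝ) × E × ℝ ↦
      residual (ℓ q.1.1) (σ q.1.1) (gain (κ q.1.1) (ℓ q.1.1) (σ q.1.1)) q.2 +
        q.1.2 • gain (κ q.1.1) (ℓ q.1.1) (σ q.1.1) := by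
  have hg : Measurable fun q : (β × ℝ) × E × ℝ ↦ gain (κ q.1.1) (ℓ q.1.1) (σ q.1.1) :=
    (measurable_gain hℓ hσ).comp (measurable_fst.comp measurable_fst)
  have hz : Measurable fun q : (β × ℝ) × E × ℝ ↦ ℓ q.1.1 q.2.1 :=
    hℓ.comp ((measurable_fst.comp measurable_fst).prodMk (measurable_fst.comp measurable_snd))
  simp only [residual_apply]
  fun_prop

theorem measurable_updatedLaw (hℓ : Measurable fun p : β × E ↦ ℓ p.1 p.2) (hσ : Measurable σ) :
    Measurable fun q : β × ℝ ↦ updatedLaw (κ q.1) (ℓ q.1) (σ q.1) q.2 := by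
  refine Measure.measurable_of_measurable_coe _ fun A hA ↦ ?_
  have h := Kernel.measurable_kernel_prodMk_left
    (κ := (κ ×ₖ Kernel.const β (gaussianReal 0 1)).comap (Prod.fst : β × ℝ → β) measurable_fst)
    (measurable_residual_add (κ := κ) hℓ hσ hA)
  convert! h using 2 with q
  rw [updatedLaw, Measure.map_apply (by fun_prop) hA, Kernel.comap_apply, Kernel.prod_apply,
    Kernel.const_apply]
  rfl

/-- The kernel `(b, z) ↦ updatedLaw (κ b) (ℓ b) (σ b) z`. -/
noncomputable def updateKernel (κ : Kernel β E) [IsMarkovKernel κ] (ℓ : β → StrongDual ℝ E)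
    (σ : β → ℝ) (hℓ : Measurable fun p : β × E ↦ ℓ p.1 p.2) (hσ : Measurable σ) :
    Kernel (β × ℝ) E where
  toFun q := updatedLaw (κ q.1) (ℓ q.1) (σ q.1) q.2
  measurable' := measurable_updatedLaw hℓ hσ

theorem updateKernel_apply (hℓ : Measurable fun p : β × E ↦ ℓ p.1 p.2) (hσ : Measurable σ)
    (q : β × ℝ) : updateKernel κ ℓ σ hℓ hσ q = updatedLaw (κ q.1) (ℓ q.1) (σ q.1) q.2 := rfl

theorem isGaussian_updateKernel (hκ : ∀ b, IsGaussian (κ b))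
    (hℓ : Measurable fun p : β × E ↦ ℓ p.1 p.2) (hσ : Measurable σ) (q : β × ℝ) :
    IsGaussian (updateKernel κ ℓ σ hℓ hσ q) :=
  have := hκ q.1
  isGaussian_map_residual_add (κ q.1) (ℓ q.1) (σ q.1) _ _

variable {α : Type*} [MeasurableSpace α] {μ : Measure α} [IsProbabilityMeasure μ]
  {X : α → β} {Y : α → E} {u : α → ℝ}

/-- If `κ` is the conditional law of `Y` given `X`, and is Gaussian, then `updateKernel κ ℓ σ` is
the conditional law of `Y` given `X` and the noisy observation `ℓ X Y + σ X * u`. -/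
theorem map_prodMk_eq_compProd_updateKernel [CompleteSpace E] (hX : Measurable X) (hY : Measurable Y)
    (hu : Measurable u) (hκ : ∀ b, IsGaussian (κ b))
    (hXY : μ.map (fun a ↦ (X a, Y a)) = μ.map X ⊗ₘ κ) (hu_law : μ.map u = gaussianReal 0 1)
    (hind : IndepFun (fun a ↦ (X a, Y a)) u μ)
    (hℓ : Measurable fun p : β × E ↦ ℓ p.1 p.2) (hσ : Measurable σ) :
    μ.map (fun a ↦ ((X a, ℓ (X a) (Y a) + σ (X a) * u a), Y a)) =
      μ.map (fun a ↦ (X a, ℓ (X a) (Y a) + σ (X a) * u a)) ⊗ₘ updateKernel κ ℓ σ hℓ hσ := by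
  have : IsMarkovKernel (updateKernel κ ℓ σ hℓ hσ) :=
    ⟨fun q ↦ (isGaussian_updateKernel hκ hℓ hσ q).toIsProbabilityMeasure⟩
  have hZ : Measurable fun q : β × E × ℝ ↦ noisyObs (ℓ q.1) (σ q.1) q.2 := by
    simp only [noisyObs_apply]
    have := hℓ.comp (measurable_fst.prodMk (measurable_fst.comp measurable_snd) :
      Measurable fun q : β × E × ℝ ↦ (q.1, q.2.1))
    exact this.add ((hσ.comp measurable_fst).mul (measurable_snd.comp measurable_snd))
  have hZ' : Measurable fun a ↦ ℓ (X a) (Y a) + σ (X a) * u a := by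
    simpa only [noisyObs_apply, Function.comp_def] using hZ.comp (hX.prodMk (hY.prodMk hu))
  ext s hs
  set ψ : (β × ℝ) × E → ENNReal := s.indicator 1 with hψ_def
  have hψ : Measurable ψ := measurable_one.indicator hs
  have hψ' : Measurable fun q : β × ℝ ↦ ∫⁻ f, ψ (q, f) ∂(updateKernel κ ℓ σ hℓ hσ q) :=
    hψ.lintegral_kernel_prod_right'
  rw [← lintegral_indicator_one hs, ← lintegral_indicator_one hs, ← hψ_def,
    lintegral_map hψ ((hX.prodMk hZ').prodMk hY), Measure.lintegral_compProd hψ,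
    lintegral_map hψ' (hX.prodMk hZ')]
  have e1 := lintegral_prodMk_noise hX hY hu hXY hu_law hind
    (F := fun q ↦ ψ ((q.1, noisyObs (ℓ q.1) (σ q.1) q.2), q.2.1)) (by fun_prop)
  have e2 := lintegral_prodMk_noise hX hY hu hXY hu_law hind
    (F := fun q ↦ ∫⁻ f, ψ ((q.1, noisyObs (ℓ q.1) (σ q.1) q.2), f)
      ∂(updateKernel κ ℓ σ hℓ hσ (q.1, noisyObs (ℓ q.1) (σ q.1) q.2)))
    (hψ'.comp (measurable_fst.prodMk hZ))
  simp only [noisyObs_apply] at e1 e2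
  rw [e1, e2]
  refine lintegral_congr fun a ↦ ?_
  have := hκ (X a)
  have e3 := lintegral_noisyObs_prodMk (κ (X a)) (ℓ (X a)) (σ (X a))
    (ψ := fun p ↦ ψ ((X a, p.1), p.2)) (by fun_prop)
  simp only [noisyObs_apply] at e3
  rw [e3]
  refine lintegral_congr fun p ↦ ?_
  rw [updateKernel_apply, updatedLaw, lintegral_map (by fun_prop) (by fun_prop)]

end Update

/-! ### Sequential updates -/

section Update

variable {𝕏 : Type*} [MetricSpace 𝕏] [CompactSpace 𝕏] [MeasurableSpace 𝕏] [BorelSpace 𝕏]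

theorem measurable_eval {γ : Type*} [MeasurableSpace γ] {f : γ → C(𝕏, ℝ)} {x : γ → 𝕏}
    (hf : Measurable f) (hx : Measurable x) : Measurable fun c ↦ f c (x c) :=
  (by fun_prop : Continuous fun p : C(𝕏, ℝ) × 𝕏 ↦ p.1 p.2).measurable.comp (hf.prodMk hx)

variable {Ω : Type*} [MeasurableSpace Ω] {μ : Measure Ω} [IsProbabilityMeasure μ]
  {ξ : Ω → C(𝕏, ℝ)} {τ : 𝕏 → ℝ} {u : Ω → ℝ}

/-- A Gaussian conditional law given `H` yields a Gaussian conditional law given `H` and a noisy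
observation at a point that depends measurably on `H`. -/
theorem exists_isGaussianCondLaw_comap_prodMk {β : Type*} [mβ : MeasurableSpace β] {H : Ω → β}
    {Q : β → GaussianMeasure 𝕏} (hξ : Measurable ξ) (hτ : Measurable τ) (hu : Measurable u)
    (hu_law : μ.map u = gaussianReal 0 1) (hH : Measurable H)
    (hind : Indep (mβ.comap H ⊔ MeasurableSpace.comap ξ inferInstance)
      (MeasurableSpace.comap u inferInstance) μ) (hQ : Measurable Q)
    (hcond : ∀ A, MeasurableSet A →
      (fun ω ↦ (Q (H ω) : Measure C(𝕏, ℝ)).real A) =ᵐ[μ] μ⟦ξ ⁻¹' A | mβ.comap H⟧)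
    {x : β → 𝕏} (hx : Measurable x) :
    ∃ P, IsGaussianCondLaw μ ξ (mβ.comap H ⊔ MeasurableSpace.comap
      (fun ω ↦ ξ ω (x (H ω)) + τ (x (H ω)) * u ω) inferInstance) P := by
  have hind' : IndepFun (fun ω ↦ (H ω, ξ ω)) u μ := by
    rw [IndepFun_iff_Indep]
    exact (MeasurableSpace.comap_prodMk H ξ).symm ▸ hind
  rw [show mβ.comap H ⊔ MeasurableSpace.comap (fun ω ↦ ξ ω (x (H ω)) + τ (x (H ω)) * u ω)
    inferInstance = MeasurableSpace.comap (fun ω ↦ (H ω, ξ ω (x (H ω)) + τ (x (H ω)) * u ω))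
      inferInstance from (MeasurableSpace.comap_prodMk H _).symm]
  let κ : Kernel β C(𝕏, ℝ) := ⟨fun b ↦ Q b, measurable_subtype_coe.comp hQ⟩
  have hκ : ∀ b, IsGaussian (κ b) := fun b ↦ (Q b).2
  have : IsMarkovKernel κ := ⟨fun b ↦ (hκ b).toIsProbabilityMeasure⟩
  have hℓ : Measurable fun p : β × C(𝕏, ℝ) ↦ ContinuousMap.evalCLM ℝ (x p.1) p.2 :=
    measurable_eval measurable_snd (hx.comp measurable_fst)
  have hσ : Measurable fun b ↦ τ (x b) := hτ.comp hx
  set κ' := updateKernel κ (fun b ↦ ContinuousMap.evalCLM ℝ (x b)) (fun b ↦ τ (x b)) hℓ hσ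
    with hκ'_def
  have hκ' : ∀ q, IsGaussian (κ' q) := isGaussian_updateKernel hκ hℓ hσ
  have : IsMarkovKernel κ' := ⟨fun b ↦ (hκ' b).toIsProbabilityMeasure⟩
  have hjoint := map_prodMk_eq_compProd_updateKernel
    (ℓ := fun b ↦ ContinuousMap.evalCLM ℝ (x b)) (σ := fun b ↦ τ (x b)) hH hξ hu hκ
    (map_prodMk_eq_compProd_of_ae_eq_condExp hH hξ hcond) hu_law hind' hℓ hσ
  have hZ : Measurable fun ω ↦ (H ω, ξ ω (x (H ω)) + τ (x (H ω)) * u ω) :=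
    hH.prodMk ((measurable_eval hξ (hx.comp hH)).add ((hσ.comp hH).mul hu))
  refine ⟨fun ω ↦ ⟨κ' (H ω, ξ ω (x (H ω)) + τ (x (H ω)) * u ω), hκ' _⟩, ?_, fun A hA ↦ ?_⟩
  · exact (κ'.measurable.comp (comap_measurable _)).subtype_mk
  · exact ae_eq_condExp_of_map_prodMk_eq_compProd (κ := κ') hZ hξ hjoint hA

/-- One step of a sequential design: a Gaussian conditional law given `ℱ'` yields a Gaussian
conditional law given `ℱ'` and a noisy observation at an `ℱ'`-measurable point. -/
theorem IsGaussianCondLaw.exists_sup_comap {Ω : Type*} {ℱ' : MeasurableSpace Ω}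
    [mΩ : MeasurableSpace Ω] {μ : Measure Ω} [IsProbabilityMeasure μ] {ξ : Ω → C(𝕏, ℝ)}
    {τ : 𝕏 → ℝ} {u : Ω → ℝ} {P : Ω → GaussianMeasure 𝕏}
    (hP : IsGaussianCondLaw μ ξ ℱ' P) (hℱ' : ℱ' ≤ mΩ)
    (hξ : Measurable ξ) (hτ : Measurable τ) (hu : Measurable u)
    (hu_law : μ.map u = gaussianReal 0 1)
    (hind : Indep (ℱ' ⊔ MeasurableSpace.comap ξ inferInstance)
      (MeasurableSpace.comap u inferInstance) μ)
    {x : Ω → 𝕏} (hx : Measurable[ℱ'] x) :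
    ∃ P', IsGaussianCondLaw μ ξ (ℱ' ⊔ MeasurableSpace.comap
      (fun ω ↦ ξ ω (x ω) + τ (x ω) * u ω) inferInstance) P' := by
  -- conditioning on `ℱ'` is conditioning on the identity map into `Ω` endowed with `ℱ'`
  have key := @exists_isGaussianCondLaw_comap_prodMk 𝕏 _ _ _ _ Ω _ μ _ ξ τ u Ω ℱ' id P hξ hτ hu
    hu_law (measurable_id'' hℱ')
  rw [MeasurableSpace.comap_id] at key
  exact key hind hP.measurable hP.ae_eq_condExp hx

end Update

section Independence

theorem indepFun_prodMk_of_indepFun_prodMk {Ω α β γ : Type*} [MeasurableSpace Ω]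
    [MeasurableSpace α] [MeasurableSpace β] [MeasurableSpace γ] {μ : Measure Ω}
    [IsProbabilityMeasure μ] {A : Ω → α} {B : Ω → β} {C : Ω → γ} (hA : Measurable A)
    (hB : Measurable B) (hC : Measurable C) (hABC : IndepFun A (fun ω ↦ (B ω, C ω)) μ)
    (hBC : IndepFun B C μ) : IndepFun (fun ω ↦ (A ω, B ω)) C μ := by
  rw [indepFun_iff_map_prod_eq_prod_map_map (hA.prodMk hB).aemeasurable hC.aemeasurable]
  have : IsProbabilityMeasure (μ.map fun ω ↦ ((A ω, B ω), C ω)) :=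
    Measure.isProbabilityMeasure_map ((hA.prodMk hB).prodMk hC).aemeasurable
  have : IsProbabilityMeasure (μ.map C) := Measure.isProbabilityMeasure_map hC.aemeasurable
  refine Measure.ext_prod₃' fun {s t v} hs ht hv ↦ ?_
  have h1 := hABC.measure_inter_preimage_eq_mul s (t ×ˢ v) hs (ht.prod hv)
  have h2 := hBC.measure_inter_preimage_eq_mul t v ht hv
  have h3 := hABC.measure_inter_preimage_eq_mul s (t ×ˢ Set.univ) hs (ht.prod .univ)
  simp only [Set.mk_preimage_prod, Set.preimage_univ, Set.inter_univ] at h1 h3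
  rw [Measure.prod_prod, Measure.map_apply ((hA.prodMk hB).prodMk hC) ((hs.prod ht).prod hv),
    Measure.map_apply (hA.prodMk hB) (hs.prod ht), Measure.map_apply hC hv,
    Set.mk_preimage_prod, Set.mk_preimage_prod, h3, Set.inter_assoc, h1, h2, mul_assoc]

end Independence

section Filtration

variable {𝕏 : Type*} [MetricSpace 𝕏] [MeasurableSpace 𝕏]
  {Ω : Type*} {ξ : Ω → C(𝕏, ℝ)} {τ : 𝕏 → ℝ} {U : ℕ → Ω → ℝ} {X : ℕ → Ω → 𝕏}

theorem obsSigma_succ (n : ℕ) : obsSigma ξ τ U X (n + 1) = obsSigma ξ τ U X n ⊔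
    (MeasurableSpace.comap (X n) inferInstance ⊔
      MeasurableSpace.comap (observation ξ τ U X n) inferInstance) := by
  refine le_antisymm (iSup_le fun i ↦ ?_) (sup_le (iSup_le fun i ↦ ?_) ?_)
  · rcases Nat.lt_succ_iff_lt_or_eq.1 i.2 with h | h
    · exact le_sup_of_le_left (le_iSup_of_le (⟨i, h⟩ : Fin n) le_rfl)
    · rw [h]
      exact le_sup_right
  · exact le_iSup_of_le i.castSucc le_rfl
  · exact le_iSup_of_le (Fin.last n) le_rfl

theorem obsSigma_mono : Monotone (obsSigma ξ τ U X) :=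
  monotone_nat_of_le_succ fun n ↦ by rw [obsSigma_succ]; exact le_sup_left

theorem IsSequentialDesign.obsSigma_succ (hX : IsSequentialDesign ξ τ U X) (n : ℕ) :
    obsSigma ξ τ U X (n + 1) = obsSigma ξ τ U X n ⊔
      MeasurableSpace.comap (observation ξ τ U X n) inferInstance := by
  rw [SequentialDesign.obsSigma_succ, ← sup_assoc, sup_eq_left.2 (hX n).comap_le]

variable [CompactSpace 𝕏] [BorelSpace 𝕏]

/-- The first `n` observations of a sequential design are functions of the process and of the first
`n` noise variables. -/
theorem IsSequentialDesign.obsSigma_le (hX : IsSequentialDesign ξ τ U X) (hτ : Measurable τ)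
    {n : ℕ} {m : MeasurableSpace Ω} (hξ : Measurable[m] ξ) (hU : ∀ i < n, Measurable[m] (U i)) :
    obsSigma ξ τ U X n ≤ m := by
  induction n with
  | zero => exact iSup_le fun i ↦ i.elim0
  | succ n ih =>
    have h := ih fun i hi ↦ hU i (hi.trans n.lt_succ_self)
    rw [hX.obsSigma_succ]
    have hXn : Measurable[m] (X n) := (hX n).mono h le_rfl
    refine sup_le h (Measurable.comap_le ?_)
    exact (measurable_eval hξ hXn).add ((hτ.comp hXn).mul (hU n n.lt_succ_self))

variable [mΩ : MeasurableSpace Ω] {μ : Measure Ω} [IsProbabilityMeasure μ]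

/-- A noise variable is independent of the process and of the preceding observations. -/
theorem IsSequentialDesign.indep_noise [Nonempty 𝕏] (hX : IsSequentialDesign ξ τ U X)
    (hξ_meas : ∀ x, Measurable fun ω ↦ ξ ω x)
    (hτ : Measurable τ) (hU_meas : ∀ n, Measurable (U n)) (hU_indep : iIndepFun U μ)
    (hUξ : IndepFun (fun (ω : Ω) (x : 𝕏) ↦ ξ ω x) (fun (ω : Ω) (n : ℕ) ↦ U n ω) μ) (n : ℕ) :
    Indep (obsSigma ξ τ U X n ⊔ MeasurableSpace.comap ξ inferInstance)
      (MeasurableSpace.comap (U n) inferInstance) μ := by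
  set A : Ω → 𝕏 → ℝ := fun ω x ↦ ξ ω x
  set B : Ω → Finset.range n → ℝ := fun ω i ↦ U i ω
  have hA : Measurable A := measurable_pi_lambda _ hξ_meas
  have hB : Measurable B := measurable_pi_lambda _ fun i ↦ hU_meas i
  have hBU : IndepFun B (U n) μ :=
    (hU_indep.indepFun_finset (Finset.range n) {n} (by simp) hU_meas).comp measurable_id
      (measurable_pi_apply (⟨n, Finset.mem_singleton_self n⟩ : ({n} : Finset ℕ)))
  have hABU : IndepFun A (fun ω ↦ (B ω, U n ω)) μ :=
    hUξ.comp (φ := id) (ψ := fun v : ℕ → ℝ ↦ ((fun i : Finset.range n ↦ v i), v n))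
      measurable_id (by fun_prop)
  have hind := indepFun_prodMk_of_indepFun_prodMk hA hB (hU_meas n) hABU hBU
  rw [IndepFun_iff_Indep] at hind
  refine indep_of_indep_of_le_left hind ?_
  set m := MeasurableSpace.comap (fun ω ↦ (A ω, B ω)) inferInstance with hm
  have hAB : Measurable[m] fun ω ↦ (A ω, B ω) := comap_measurable _
  have hξm : Measurable[m] ξ := by
    refine @measurable_of_measurable_eval 𝕏 _ _ _ Ω m ξ fun x ↦ ?_
    exact (measurable_pi_apply x).comp (measurable_fst.comp hAB)
  refine sup_le (hX.obsSigma_le hτ hξm fun i hi ↦ ?_) hξm.comap_le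
  exact (measurable_pi_apply (⟨i, Finset.mem_range.2 hi⟩ : Finset.range n)).comp
    (measurable_snd.comp hAB)

/-- The conditional law of the process given finitely many observations of a sequential design is
Gaussian. -/
theorem IsSequentialDesign.exists_isGaussianCondLaw [Nonempty 𝕏] (hX : IsSequentialDesign ξ τ U X)
    (hξ_meas : ∀ x, Measurable fun ω ↦ ξ ω x)
    (hξ_gauss : IsGaussianProcess (fun (x : 𝕏) (ω : Ω) ↦ ξ ω x) μ)
    (hτ : Measurable τ) (hU_meas : ∀ n, Measurable (U n))
    (hU_law : ∀ n, μ.map (U n) = gaussianReal 0 1) (hU_indep : iIndepFun U μ)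
    (hUξ : IndepFun (fun (ω : Ω) (x : 𝕏) ↦ ξ ω x) (fun (ω : Ω) (n : ℕ) ↦ U n ω) μ) (n : ℕ) :
    ∃ P, IsGaussianCondLaw μ ξ (obsSigma ξ τ U X n) P := by
  have hξ : Measurable ξ := measurable_of_measurable_eval hξ_meas
  induction n with
  | zero =>
    have h0 : obsSigma ξ τ U X 0 = ⊥ := iSup_of_empty _
    rw [h0]
    refine ⟨fun _ ↦ ⟨μ.map ξ, isGaussian_map_of_isGaussianProcess hξ hξ_gauss⟩,
      measurable_const, fun A hA ↦ ?_⟩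
    rw [condExp_bot]
    refine ae_of_all _ fun ω ↦ ?_
    simp only [Measure.real, Measure.map_apply hξ hA]
    rw [integral_indicator_const _ (hξ hA)]
    simp [Measure.real]
  | succ n ih =>
    obtain ⟨P, hP⟩ := ih
    rw [hX.obsSigma_succ]
    exact hP.exists_sup_comap (hX.obsSigma_le hτ hξ fun i _ ↦ hU_meas i) hξ hτ (hU_meas n)
      (hU_law n) (hX.indep_noise hξ_meas hτ hU_meas hU_indep hUξ n) (hX n)

end Filtration

/-! ### Uniform convergence of means and covariances -/

section UniformLimits

variable {Y : Type*}

theorem tendstoUniformly_sum_mul {ι : Type*} (s : Finset ι) {c : ℕ → ι → ℝ} {c' : ι → ℝ}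
    {ψ : ι → Y → ℝ} (hψ : ∀ i ∈ s, ∀ y, |ψ i y| ≤ 1)
    (hc : ∀ i ∈ s, Tendsto (fun n ↦ c n i) atTop (𝓝 (c' i))) :
    TendstoUniformly (fun n y ↦ ∑ i ∈ s, c n i * ψ i y) (fun y ↦ ∑ i ∈ s, c' i * ψ i y)
      atTop := by
  have h : Tendsto (fun n ↦ ∑ i ∈ s, |c' i - c n i|) atTop (𝓝 0) := by
    have := tendsto_finsetSum s fun i hi ↦ ((hc i hi).const_sub (c' i)).abs
    simpa using this
  rw [Metric.tendstoUniformly_iff]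
  intro ε hε
  filter_upwards [h.eventually_lt_const hε] with n hn y
  rw [Real.dist_eq, ← Finset.sum_sub_distrib]
  refine lt_of_le_of_lt ((Finset.abs_sum_le_sum_abs _ _).trans (Finset.sum_le_sum fun i hi ↦ ?_)) hn
  rw [← sub_mul, abs_mul]
  exact mul_le_of_le_one_right (abs_nonneg _) (hψ i hi y)

/-- Uniform convergence of functions that can be approximated, with controlled errors, by uniformly
convergent ones. -/
theorem tendstoUniformly_of_approx {F : ℕ → Y → ℝ} {F' : Y → ℝ} {G : ℕ → ℕ → Y → ℝ}
    {G' : ℕ → Y → ℝ} {a : ℕ → ℕ → ℝ} {a' : ℕ → ℝ}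
    (hG : ∀ k, TendstoUniformly (G k) (G' k) atTop)
    (hF : ∀ k n y, |F n y - G k n y| ≤ a k n) (hF' : ∀ k y, |F' y - G' k y| ≤ a' k)
    (ha : ∀ k, Tendsto (a k) atTop (𝓝 (a' k))) (ha' : Tendsto a' atTop (𝓝 0)) :
    TendstoUniformly F F' atTop := by
  rw [Metric.tendstoUniformly_iff]
  intro ε hε
  obtain ⟨k, hk⟩ := (ha'.eventually_lt_const (show (0 : ℝ) < ε / 3 by positivity)).exists
  filter_upwards [(ha k).eventually_lt_const hk,
    Metric.tendstoUniformly_iff.1 (hG k) (ε / 3) (by positivity)] with n h1 h2 y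
  have h3 := hF k n y
  have h4 := hF' k y
  have h5 := h2 y
  rw [Real.dist_eq] at h5 ⊢
  rw [abs_le] at h3 h4
  rw [abs_lt] at h5 ⊢
  constructor <;> linarith

end UniformLimits

section GaussianConvergence

variable {𝕏 : Type*} [MetricSpace 𝕏] [CompactSpace 𝕏]

/-- The error `f - ∑ i ∈ t, f (d i) • φ i` of the interpolation of `f`. -/
noncomputable def interpError (d : ℕ → 𝕏) (t : Finset ℕ) (φ : ℕ → C(𝕏, ℝ)) :
    C(𝕏, ℝ) →L[ℝ] C(𝕏, ℝ) :=
  ContinuousLinearMap.id ℝ _ - ∑ i ∈ t, (ContinuousMap.evalCLM ℝ (d i)).smulRight (φ i)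

theorem interpError_apply (d : ℕ → 𝕏) (t : Finset ℕ) (φ : ℕ → C(𝕏, ℝ)) (f : C(𝕏, ℝ)) :
    interpError d t φ f = f - ∑ i ∈ t, f (d i) • φ i := by
  simp [interpError]

variable {d : ℕ → 𝕏} {t : ℕ → Finset ℕ} {φ : ℕ → ℕ → C(𝕏, ℝ)}

theorem InterpolationScheme.tendsto_interpError (h : InterpolationScheme d t φ) (f : C(𝕏, ℝ)) :
    Tendsto (fun k ↦ ‖interpError d (t k) (φ k) f‖) atTop (𝓝 0) := by
  simp only [interpError_apply]
  simpa using ((h.tendsto f).const_sub f).norm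

theorem InterpolationScheme.abs_interp_le (h : InterpolationScheme d t φ) (k : ℕ) (f : C(𝕏, ℝ))
    (y : 𝕏) : |∑ i ∈ t k, f (d i) * φ k i y| ≤ ‖f‖ := by
  calc |∑ i ∈ t k, f (d i) * φ k i y| ≤ ∑ i ∈ t k, |f (d i) * φ k i y| :=
        Finset.abs_sum_le_sum_abs _ _
    _ ≤ ∑ i ∈ t k, ‖f‖ * φ k i y := Finset.sum_le_sum fun i _ ↦ by
        rw [abs_mul, abs_of_nonneg (h.nonneg k i y)]
        exact mul_le_mul_of_nonneg_right (f.norm_coe_le_norm _) (h.nonneg k i y)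
    _ = ‖f‖ := by rw [← Finset.mul_sum, h.sum_eq_one, mul_one]

theorem InterpolationScheme.norm_interpError_le (h : InterpolationScheme d t φ) (k : ℕ)
    (f : C(𝕏, ℝ)) : ‖interpError d (t k) (φ k) f‖ ≤ 2 * ‖f‖ := by
  rw [ContinuousMap.norm_le _ (by positivity)]
  intro y
  have h1 := h.abs_interp_le k f y
  have h2 := f.norm_coe_le_norm y
  simp only [interpError_apply, ContinuousMap.sub_apply, ContinuousMap.sum_apply,
    ContinuousMap.smul_apply, smul_eq_mul, Real.norm_eq_abs] at h2 ⊢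
  exact (abs_sub _ _).trans (by linarith)

theorem abs_covariance_le {Ω : Type*} [MeasurableSpace Ω] {ρ : Measure Ω} [IsProbabilityMeasure ρ]
    {A B V W : Ω → ℝ} (hA : MemLp A 2 ρ) (hB : MemLp B 2 ρ) (hV : MemLp V 2 ρ) (hW : MemLp W 2 ρ)
    (hAV : ∀ ω, |A ω| ≤ V ω) (hBW : ∀ ω, |B ω| ≤ W ω) :
    |cov[A, B; ρ]| ≤ ∫ ω, V ω * W ω ∂ρ + (∫ ω, V ω ∂ρ) * ∫ ω, W ω ∂ρ := by
  have h0 : ∀ ω, 0 ≤ V ω := fun ω ↦ (abs_nonneg _).trans (hAV ω)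
  rw [covariance_eq_sub hA hB]
  refine (abs_sub _ _).trans (add_le_add ?_ ?_)
  · refine (norm_integral_le_integral_norm _).trans (integral_mono (hA.integrable_mul hB).norm
      (hV.integrable_mul hW) fun ω ↦ ?_)
    simp only [Pi.mul_apply, norm_mul, Real.norm_eq_abs]
    exact mul_le_mul (hAV ω) (hBW ω) (abs_nonneg _) (h0 ω)
  · rw [abs_mul]
    refine mul_le_mul ?_ ?_ (abs_nonneg _) (integral_nonneg h0)
    · exact (norm_integral_le_integral_norm _).trans (integral_mono (hA.integrable (by simp)).norm
        (hV.integrable (by simp)) hAV)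
    · exact (norm_integral_le_integral_norm _).trans (integral_mono (hB.integrable (by simp)).norm
        (hW.integrable (by simp)) hBW)

variable (ν : Measure C(𝕏, ℝ)) [IsGaussian ν]

theorem memLp_norm : MemLp (fun f : C(𝕏, ℝ) ↦ ‖f‖) 2 ν := (IsGaussian.memLp_two_id (μ := ν)).norm

theorem memLp_norm_clm (T : C(𝕏, ℝ) →L[ℝ] C(𝕏, ℝ)) : MemLp (fun f ↦ ‖T f‖) 2 ν :=
  (T.comp_memLp' (IsGaussian.memLp_two_id (μ := ν))).norm

theorem memLp_eval (x : 𝕏) : MemLp (fun f : C(𝕏, ℝ) ↦ f x) 2 ν :=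
  IsGaussian.memLp_dual ν (ContinuousMap.evalCLM ℝ x) 2 (by simp)

theorem InterpolationScheme.abs_mean_sub_le (k : ℕ) (y : 𝕏) :
    |∫ f : C(𝕏, ℝ), f y ∂ν - ∑ i ∈ t k, (∫ f : C(𝕏, ℝ), f (d i) ∂ν) * φ k i y| ≤
      ∫ f, ‖interpError d (t k) (φ k) f‖ ∂ν := by
  have hi : ∀ x : 𝕏, Integrable (fun f : C(𝕏, ℝ) ↦ f x) ν := fun x ↦
    (memLp_eval ν x).integrable (by simp)
  simp only [← integral_mul_const]
  rw [← integral_finsetSum _ fun i _ ↦ (hi (d i)).mul_const _,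
    ← integral_sub (hi y) (integrable_finsetSum _ fun i _ ↦ (hi (d i)).mul_const _)]
  refine (norm_integral_le_integral_norm _).trans (integral_mono
    ((hi y).sub (integrable_finsetSum _ fun i _ ↦ (hi (d i)).mul_const _)).norm
    ((memLp_norm_clm ν _).integrable (by simp)) fun f ↦ ?_)
  have := (interpError d (t k) (φ k) f).norm_coe_le_norm y
  simpa [interpError_apply] using this

/-- With `f = T f + R f`, where `R f` is the interpolant and `T f` the error, the difference of the
covariances is `cov (T f x, f y) + cov (T f y, R f x)`. -/
theorem InterpolationScheme.abs_cov_sub_le (h : InterpolationScheme d t φ) (k : ℕ) (x y : 𝕏) :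
    |cov[fun f : C(𝕏, ℝ) ↦ f x, fun f ↦ f y; ν] - ∑ p ∈ t k ×ˢ t k,
        cov[fun f : C(𝕏, ℝ) ↦ f (d p.1), fun f ↦ f (d p.2); ν] * (φ k p.1 x * φ k p.2 y)| ≤
      2 * (∫ f, ‖interpError d (t k) (φ k) f‖ * ‖f‖ ∂ν +
        (∫ f, ‖interpError d (t k) (φ k) f‖ ∂ν) * ∫ f, ‖f‖ ∂ν) := by
  set R : 𝕏 → C(𝕏, ℝ) → ℝ := fun x f ↦ ∑ i ∈ t k, f (d i) * φ k i x with hR_def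
  set T : 𝕏 → C(𝕏, ℝ) → ℝ := fun x f ↦ interpError d (t k) (φ k) f x with hT_def
  have hterm : ∀ x i, MemLp (fun f : C(𝕏, ℝ) ↦ f (d i) * φ k i x) 2 ν := fun x i ↦ by
    simpa only [mul_comm] using (memLp_eval ν (d i)).const_mul (φ k i x)
  have hR : ∀ x, MemLp (R x) 2 ν := fun x ↦ memLp_finsetSum _ fun i _ ↦ hterm x i
  have hT : ∀ x, MemLp (T x) 2 ν := fun x ↦ IsGaussian.memLp_dual ν
    ((ContinuousMap.evalCLM ℝ x).comp (interpError d (t k) (φ k))) 2 (by simp)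
  have hsplit : ∀ x, (fun f : C(𝕏, ℝ) ↦ f x) = T x + R x := fun x ↦ by
    ext f; simp [hT_def, hR_def, interpError_apply]
  have hsum : ∑ p ∈ t k ×ˢ t k,
      cov[fun f : C(𝕏, ℝ) ↦ f (d p.1), fun f ↦ f (d p.2); ν] * (φ k p.1 x * φ k p.2 y) =
      cov[R x, R y; ν] := by
    rw [hR_def, covariance_fun_sum_fun_sum' (fun i _ ↦ hterm x i) (fun i _ ↦ hterm y i),
      Finset.sum_product]
    refine Finset.sum_congr rfl fun i _ ↦ Finset.sum_congr rfl fun j _ ↦ ?_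
    rw [covariance_mul_const_left, covariance_mul_const_right]
    ring
  have hcov : cov[fun f : C(𝕏, ℝ) ↦ f x, fun f ↦ f y; ν] - cov[R x, R y; ν] =
      cov[T x, fun f : C(𝕏, ℝ) ↦ f y; ν] + cov[T y, R x; ν] := by
    rw [hsplit x, covariance_add_left (hT x) (hR x) (memLp_eval ν y)]
    nth_rewrite 2 [hsplit y]
    rw [covariance_add_right (hR x) (hT y) (hR y), covariance_comm (R x) (T y)]
    ring
  have hTb : ∀ x f, |T x f| ≤ ‖interpError d (t k) (φ k) f‖ := fun x f ↦
    (interpError d (t k) (φ k) f).norm_coe_le_norm x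
  rw [hsum, hcov, two_mul]
  refine (abs_add_le _ _).trans (add_le_add ?_ ?_)
  · exact abs_covariance_le (hT x) (memLp_eval ν y) (memLp_norm_clm ν _) (memLp_norm ν) (hTb x)
      fun f ↦ f.norm_coe_le_norm y
  · exact abs_covariance_le (hT y) (hR x) (memLp_norm_clm ν _) (memLp_norm ν) (hTb y)
      fun f ↦ h.abs_interp_le k f x

theorem InterpolationScheme.tendsto_integral_norm_interpError (h : InterpolationScheme d t φ) :
    Tendsto (fun k ↦ ∫ f, ‖interpError d (t k) (φ k) f‖ ∂ν) atTop (𝓝 0) := by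
  have := tendsto_integral_of_dominated_convergence (μ := ν)
    (F := fun k f ↦ ‖interpError d (t k) (φ k) f‖) (f := fun _ ↦ 0) (fun f ↦ 2 * ‖f‖)
    (fun k ↦ (memLp_norm_clm ν _).1) (((memLp_norm ν).integrable (by simp)).const_mul 2)
    (fun k ↦ ae_of_all _ fun f ↦ by simpa using h.norm_interpError_le k f)
    (ae_of_all _ fun f ↦ h.tendsto_interpError f)
  simpa using this

theorem InterpolationScheme.tendsto_integral_norm_interpError_mul
    (h : InterpolationScheme d t φ) :
    Tendsto (fun k ↦ ∫ f, ‖interpError d (t k) (φ k) f‖ * ‖f‖ ∂ν) atTop (𝓝 0) := by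
  have := tendsto_integral_of_dominated_convergence (μ := ν)
    (F := fun k f ↦ ‖interpError d (t k) (φ k) f‖ * ‖f‖) (f := fun _ ↦ 0)
    (fun f ↦ 2 * (‖f‖ * ‖f‖))
    (fun k ↦ ((memLp_norm_clm ν _).integrable_mul (memLp_norm ν)).1)
    (((memLp_norm ν).integrable_mul (memLp_norm ν)).const_mul 2)
    (fun k ↦ ae_of_all _ fun f ↦ by
      have := mul_le_mul_of_nonneg_right (h.norm_interpError_le k f) (norm_nonneg f)
      rw [norm_mul, norm_norm, norm_norm]
      linarith)
    (ae_of_all _ fun f ↦ by simpa using (h.tendsto_interpError f).mul_const ‖f‖)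
  simpa using this

/-- The means and covariances of Gaussian measures on `C(𝕏, ℝ)` converge uniformly as soon as they
converge at a sequence of nodes and certain moments of the interpolation errors converge. -/
theorem gaussianTendsto_of_tendsto_integral (h : InterpolationScheme d t φ)
    {ν : ℕ → GaussianMeasure 𝕏} {ν' : GaussianMeasure 𝕏}
    (h_eval : ∀ i, Tendsto (fun n ↦ ∫ f, f (d i) ∂(ν n : Measure C(𝕏, ℝ))) atTop
      (𝓝 (∫ f, f (d i) ∂(ν' : Measure C(𝕏, ℝ)))))
    (h_eval_mul : ∀ i j, Tendsto (fun n ↦ ∫ f, f (d i) * f (d j) ∂(ν n : Measure C(𝕏, ℝ))) atTop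
      (𝓝 (∫ f, f (d i) * f (d j) ∂(ν' : Measure C(𝕏, ℝ)))))
    (h_norm : Tendsto (fun n ↦ ∫ f, ‖f‖ ∂(ν n : Measure C(𝕏, ℝ))) atTop
      (𝓝 (∫ f, ‖f‖ ∂(ν' : Measure C(𝕏, ℝ)))))
    (h_err : ∀ k, Tendsto
      (fun n ↦ ∫ f, ‖interpError d (t k) (φ k) f‖ ∂(ν n : Measure C(𝕏, ℝ))) atTop
      (𝓝 (∫ f, ‖interpError d (t k) (φ k) f‖ ∂(ν' : Measure C(𝕏, ℝ)))))
    (h_err_mul : ∀ k, Tendsto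
      (fun n ↦ ∫ f, ‖interpError d (t k) (φ k) f‖ * ‖f‖ ∂(ν n : Measure C(𝕏, ℝ))) atTop
      (𝓝 (∫ f, ‖interpError d (t k) (φ k) f‖ * ‖f‖ ∂(ν' : Measure C(𝕏, ℝ))))) :
    GaussianTendsto ν ν' := by
  have hν : ∀ n, IsGaussian (ν n : Measure C(𝕏, ℝ)) := fun n ↦ (ν n).2
  have hν' : IsGaussian (ν' : Measure C(𝕏, ℝ)) := ν'.2
  have hφ : ∀ k, ∀ i ∈ t k, ∀ y, |φ k i y| ≤ 1 := fun k i hi y ↦ by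
    rw [abs_of_nonneg (h.nonneg k i y)]
    exact h.le_one hi y
  constructor
  · exact tendstoUniformly_of_approx
      (fun k ↦ tendstoUniformly_sum_mul (t k) (hφ k) fun i _ ↦ h_eval i)
      (fun k n y ↦ InterpolationScheme.abs_mean_sub_le (ν n : Measure C(𝕏, ℝ)) k y)
      (fun k y ↦ InterpolationScheme.abs_mean_sub_le (ν' : Measure C(𝕏, ℝ)) k y) h_err
      (h.tendsto_integral_norm_interpError (ν' : Measure C(𝕏, ℝ)))
  · have hcov : ∀ i j, Tendsto
        (fun n ↦ cov[fun f : C(𝕏, ℝ) ↦ f (d i), fun f ↦ f (d j); (ν n : Measure C(𝕏, ℝ))]) atTop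
        (𝓝 (cov[fun f : C(𝕏, ℝ) ↦ f (d i), fun f ↦ f (d j); (ν' : Measure C(𝕏, ℝ))])) := by
      intro i j
      rw [covariance_eq_sub (memLp_eval _ _) (memLp_eval _ _)]
      refine ((h_eval_mul i j).sub ((h_eval i).mul (h_eval j))).congr fun n ↦ ?_
      rw [covariance_eq_sub (memLp_eval _ _) (memLp_eval _ _)]
      rfl
    have hG : ∀ k, TendstoUniformly
        (fun n (p : 𝕏 × 𝕏) ↦ ∑ q ∈ t k ×ˢ t k, cov[fun f : C(𝕏, ℝ) ↦ f (d q.1),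
          fun f ↦ f (d q.2); (ν n : Measure C(𝕏, ℝ))] * (φ k q.1 p.1 * φ k q.2 p.2))
        (fun p ↦ ∑ q ∈ t k ×ˢ t k, cov[fun f : C(𝕏, ℝ) ↦ f (d q.1),
          fun f ↦ f (d q.2); (ν' : Measure C(𝕏, ℝ))] * (φ k q.1 p.1 * φ k q.2 p.2)) atTop := by
      refine fun k ↦ tendstoUniformly_sum_mul (t k ×ˢ t k) (fun q hq p ↦ ?_)
        fun q _ ↦ hcov q.1 q.2
      rw [abs_mul]
      exact mul_le_one₀ (hφ k _ (Finset.mem_product.1 hq).1 _) (abs_nonneg _)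
        (hφ k _ (Finset.mem_product.1 hq).2 _)
    have ha := fun k ↦ ((h_err_mul k).add ((h_err k).mul h_norm)).const_mul 2
    refine tendstoUniformly_of_approx hG (fun k n p ↦ ?_) (fun k p ↦ ?_) ha ?_
    · exact h.abs_cov_sub_le (ν n : Measure C(𝕏, ℝ)) k p.1 p.2
    · exact h.abs_cov_sub_le (ν' : Measure C(𝕏, ℝ)) k p.1 p.2
    · have h1 := h.tendsto_integral_norm_interpError (ν' : Measure C(𝕏, ℝ))
      have h2 := h.tendsto_integral_norm_interpError_mul (ν' : Measure C(𝕏, ℝ))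
      simpa using (h2.add (h1.mul_const (∫ f, ‖f‖ ∂(ν' : Measure C(𝕏, ℝ))))).const_mul 2

end GaussianConvergence

/-! ### The limiting conditional law -/

section GaussianForm

variable {𝕏 : Type*} [MetricSpace 𝕏] {d : ℕ → 𝕏}

/-- The characteristic functions of the rational combinations `ratEval d q` under `ν`, written in
terms of their cosine and sine parts, have the Gaussian form at all rational points. Countably many
conditions are used so that they hold simultaneously almost surely. -/
def HasGaussianForm (d : ℕ → 𝕏) (ν : Measure C(𝕏, ℝ)) : Prop :=
  ∀ (q : ℕ →₀ ℚ) (s : ℚ),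
    ((∫ f, Real.cos (s * ratEval d q f) ∂ν : ℝ) : ℂ) +
        ((∫ f, Real.sin (s * ratEval d q f) ∂ν : ℝ) : ℂ) * Complex.I =
      Complex.exp (s * (∫ f, ratEval d q f ∂ν : ℝ) * Complex.I -
        ((∫ f, ratEval d q f ^ 2 ∂ν - (∫ f, ratEval d q f ∂ν) ^ 2 : ℝ) : ℂ) * (s : ℂ) ^ 2 / 2)

theorem integrable_cos (ν : Measure C(𝕏, ℝ)) [IsProbabilityMeasure ν]
    (L : C(𝕏, ℝ) →L[ℝ] ℝ) (s : ℝ) : Integrable (fun f ↦ Real.cos (s * L f)) ν :=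
  (integrable_const (1 : ℝ)).mono'
    (by fun_prop : Continuous fun f ↦ Real.cos (s * L f)).aestronglyMeasurable
    (ae_of_all _ fun _ ↦ Real.abs_cos_le_one _)

theorem integrable_sin (ν : Measure C(𝕏, ℝ)) [IsProbabilityMeasure ν]
    (L : C(𝕏, ℝ) →L[ℝ] ℝ) (s : ℝ) : Integrable (fun f ↦ Real.sin (s * L f)) ν :=
  (integrable_const (1 : ℝ)).mono'
    (by fun_prop : Continuous fun f ↦ Real.sin (s * L f)).aestronglyMeasurable
    (ae_of_all _ fun _ ↦ Real.abs_sin_le_one _)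

theorem charFun_map_eq_cos_add_sin (ν : Measure C(𝕏, ℝ)) [IsProbabilityMeasure ν]
    (L : C(𝕏, ℝ) →L[ℝ] ℝ) (s : ℝ) : charFun (ν.map L) s =
      ((∫ f, Real.cos (s * L f) ∂ν : ℝ) : ℂ) +
        ((∫ f, Real.sin (s * L f) ∂ν : ℝ) : ℂ) * Complex.I := by
  rw [charFun_apply_real, integral_map (by fun_prop) (by fun_prop), ← integral_complex_ofReal,
    ← integral_complex_ofReal, ← integral_mul_const, ← integral_add (integrable_cos ν L s).ofReal
      ((integrable_sin ν L s).ofReal.mul_const _)]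
  refine integral_congr_ae (ae_of_all _ fun f ↦ ?_)
  simp [Complex.exp_mul_I]

theorem measurableSet_hasGaussianForm {β : Type*} [MeasurableSpace β]
    (κ : Kernel β C(𝕏, ℝ)) : MeasurableSet {b | HasGaussianForm d (κ b)} := by
  have hm : ∀ {g : C(𝕏, ℝ) → ℝ}, Continuous g → Measurable fun b ↦ ∫ f, g f ∂(κ b) :=
    fun hg ↦ (hg.stronglyMeasurable.integral_kernel).measurable
  simp only [HasGaussianForm, Set.ofPred_forall]
  refine MeasurableSet.iInter fun q ↦ MeasurableSet.iInter fun s ↦ measurableSet_eq_fun ?_ ?_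
  · have h1 := hm (g := fun f ↦ Real.cos (s * ratEval d q f)) (by fun_prop)
    have h2 := hm (g := fun f ↦ Real.sin (s * ratEval d q f)) (by fun_prop)
    fun_prop
  · have h1 := hm (g := fun f ↦ ratEval d q f) (by fun_prop)
    have h2 := hm (g := fun f ↦ ratEval d q f ^ 2) (by fun_prop)
    fun_prop

theorem HasGaussianForm.of_tendsto {ν : ℕ → Measure C(𝕏, ℝ)} {ν' : Measure C(𝕏, ℝ)}
    (h : ∀ n, HasGaussianForm d (ν n))
    (h_cos : ∀ (q : ℕ →₀ ℚ) (s : ℚ), Tendsto (fun n ↦ ∫ f, Real.cos (s * ratEval d q f) ∂(ν n))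
      atTop (𝓝 (∫ f, Real.cos (s * ratEval d q f) ∂ν')))
    (h_sin : ∀ (q : ℕ →₀ ℚ) (s : ℚ), Tendsto (fun n ↦ ∫ f, Real.sin (s * ratEval d q f) ∂(ν n))
      atTop (𝓝 (∫ f, Real.sin (s * ratEval d q f) ∂ν')))
    (h_one : ∀ q : ℕ →₀ ℚ, Tendsto (fun n ↦ ∫ f, ratEval d q f ∂(ν n)) atTop
      (𝓝 (∫ f, ratEval d q f ∂ν')))
    (h_sq : ∀ q : ℕ →₀ ℚ, Tendsto (fun n ↦ ∫ f, ratEval d q f ^ 2 ∂(ν n)) atTop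
      (𝓝 (∫ f, ratEval d q f ^ 2 ∂ν'))) : HasGaussianForm d ν' := by
  intro q s
  have hof : ∀ {a : ℕ → ℝ} {a' : ℝ}, Tendsto a atTop (𝓝 a') →
      Tendsto (fun n ↦ (a n : ℂ)) atTop (𝓝 (a' : ℂ)) := fun ha ↦
    (Complex.continuous_ofReal.tendsto _).comp ha
  refine tendsto_nhds_unique ((hof (h_cos q s)).add ((hof (h_sin q s)).mul_const Complex.I)) ?_
  simp only [h _ q s]
  exact (Complex.continuous_exp.tendsto _).comp
    ((((hof (h_one q)).const_mul (s : ℂ)).mul_const Complex.I).sub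
      (((hof ((h_sq q).sub ((h_one q).pow 2))).mul_const _).div_const 2))

variable [CompactSpace 𝕏]

theorem hasGaussianForm_of_isGaussian (ν : Measure C(𝕏, ℝ)) [IsGaussian ν] :
    HasGaussianForm d ν := by
  intro q s
  have hm := IsGaussian.memLp_dual ν (ratEval d q) 2 (by simp)
  have hv : Var[ratEval d q; ν] = ∫ f, ratEval d q f ^ 2 ∂ν - (∫ f, ratEval d q f ∂ν) ^ 2 :=
    variance_eq_sub hm
  have h := charFun_map_eq_cos_add_sin ν (ratEval d q) s
  rw [IsGaussian.map_eq_gaussianReal, charFun_gaussianReal] at h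
  rw [← hv]
  simpa [variance_nonneg] using h.symm

theorem HasGaussianForm.isGaussian (hd : DenseRange d) {ν : Measure C(𝕏, ℝ)}
    [IsProbabilityMeasure ν] (h : HasGaussianForm d ν) : IsGaussian ν := by
  refine isGaussian_of_ratEval hd fun q ↦ ?_
  have : IsProbabilityMeasure (ν.map (ratEval d q)) :=
    Measure.isProbabilityMeasure_map (by fun_prop)
  refine isGaussian_of_charFun_rat (m := ∫ f, ratEval d q f ∂ν)
    (v := ∫ f, ratEval d q f ^ 2 ∂ν - (∫ f, ratEval d q f ∂ν) ^ 2) fun s ↦ ?_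
  rw [charFun_map_eq_cos_add_sin]
  exact h q s

end GaussianForm

section Limit

variable {𝕏 : Type*} [MetricSpace 𝕏] [CompactSpace 𝕏]

theorem integral_ae_eq_condExp_of_comap {Ω β : Type*} [mβ : MeasurableSpace β]
    [mΩ : MeasurableSpace Ω] {μ : Measure Ω} [IsProbabilityMeasure μ] {ξ : Ω → C(𝕏, ℝ)}
    (hξ : Measurable ξ) {H : Ω → β} (hH : Measurable H) {Q : β → GaussianMeasure 𝕏}
    (hQ : Measurable Q)
    (hcond : ∀ A, MeasurableSet A →
      (fun ω ↦ (Q (H ω) : Measure C(𝕏, ℝ)).real A) =ᵐ[μ] μ⟦ξ ⁻¹' A | mβ.comap H⟧)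
    {g : C(𝕏, ℝ) → ℝ} (hg : Continuous g) (hgi : Integrable g (μ.map ξ)) :
    (fun ω ↦ ∫ f, g f ∂(Q (H ω) : Measure C(𝕏, ℝ))) =ᵐ[μ] μ[fun ω ↦ g (ξ ω) | mβ.comap H] := by
  let κ : Kernel β C(𝕏, ℝ) := ⟨fun b ↦ Q b, measurable_subtype_coe.comp hQ⟩
  have : IsMarkovKernel κ := ⟨fun b ↦ (Q b).2.toIsProbabilityMeasure⟩
  exact integral_ae_eq_condExp_of_map_prodMk_eq_compProd hH hξ
    (map_prodMk_eq_compProd_of_ae_eq_condExp (κ := κ) hH hξ hcond) hg.stronglyMeasurable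
    (hgi.comp_measurable hξ)

/-- Integrals with respect to a conditional law are conditional expectations. -/
theorem IsGaussianCondLaw.integral_ae_eq_condExp {Ω : Type*} {ℱ' : MeasurableSpace Ω}
    [mΩ : MeasurableSpace Ω] {μ : Measure Ω} [IsProbabilityMeasure μ] {ξ : Ω → C(𝕏, ℝ)}
    {P : Ω → GaussianMeasure 𝕏} (hP : IsGaussianCondLaw μ ξ ℱ' P) (hℱ' : ℱ' ≤ mΩ)
    (hξ : Measurable ξ) {g : C(𝕏, ℝ) → ℝ} (hg : Continuous g) (hgi : Integrable g (μ.map ξ)) :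
    (fun ω ↦ ∫ f, g f ∂(P ω : Measure C(𝕏, ℝ))) =ᵐ[μ] μ[fun ω ↦ g (ξ ω) | ℱ'] := by
  have key := @integral_ae_eq_condExp_of_comap 𝕏 _ _ Ω Ω ℱ' mΩ μ _ ξ hξ id (measurable_id'' hℱ')
    P hP.measurable
  rw [MeasurableSpace.comap_id] at key
  exact key hP.ae_eq_condExp hg hgi

variable {Ω : Type*} [mΩ : MeasurableSpace Ω] {μ : Measure Ω} [IsProbabilityMeasure μ]
  {ξ : Ω → C(𝕏, ℝ)} {ℱ : Filtration ℕ mΩ} {P : ℕ → Ω → GaussianMeasure 𝕏}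

/-- Lévy's upward theorem for the integrals of a fixed function. -/
theorem ae_tendsto_integral (hξ : Measurable ξ) (hP : ∀ n, IsGaussianCondLaw μ ξ (ℱ n) (P n))
    {R : Ω → Measure C(𝕏, ℝ)} {g : C(𝕏, ℝ) → ℝ} (hg : Continuous g)
    (hgi : Integrable g (μ.map ξ))
    (hR : (fun ω ↦ ∫ f, g f ∂(R ω)) =ᵐ[μ] μ[fun ω ↦ g (ξ ω) | ⨆ n, ℱ n]) :
    ∀ᵐ ω ∂μ, Tendsto (fun n ↦ ∫ f, g f ∂(P n ω : Measure C(𝕏, ℝ))) atTop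
      (𝓝 (∫ f, g f ∂(R ω))) := by
  have h1 : ∀ᵐ ω ∂μ, ∀ n, ∫ f, g f ∂(P n ω : Measure C(𝕏, ℝ)) =
      (μ[fun ω ↦ g (ξ ω) | ℱ n]) ω :=
    ae_all_iff.2 fun n ↦ (hP n).integral_ae_eq_condExp (ℱ.le n) hξ hg hgi
  filter_upwards [h1, hR, tendsto_ae_condExp (μ := μ) (ℱ := ℱ) fun ω ↦ g (ξ ω)] with ω h1 h2 h3
  simp only [h1, h2]
  exact h3

/-- The regular conditional law given the limit sigma-algebra is almost surely Gaussian, since its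
characteristic functions and moments are limits of those of the Gaussian measures `P n`. -/
theorem exists_isGaussianCondLaw_comap [Nonempty 𝕏] (hξ : Measurable ξ)
    (hξ_gauss : IsGaussian (μ.map ξ)) (hP : ∀ n, IsGaussianCondLaw μ ξ (ℱ n) (P n)) {β : Type*}
    [mβ : MeasurableSpace β] {H : Ω → β} (hH : Measurable H) (hℱ : ⨆ n, ℱ n = mβ.comap H) :
    ∃ P', IsGaussianCondLaw μ ξ (mβ.comap H) P' := by
  set d := TopologicalSpace.denseSeq 𝕏
  have hd : DenseRange d := TopologicalSpace.denseRange_denseSeq 𝕏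
  set κ : Kernel β C(𝕏, ℝ) := condDistrib ξ H μ
  have hκ : ∀ {g : C(𝕏, ℝ) → ℝ}, Continuous g → Integrable g (μ.map ξ) →
      ∀ᵐ ω ∂μ, Tendsto (fun n ↦ ∫ f, g f ∂(P n ω : Measure C(𝕏, ℝ))) atTop
        (𝓝 (∫ f, g f ∂(κ (H ω)))) := fun {g} hg hgi ↦
    ae_tendsto_integral hξ hP hg hgi (by
      rw [hℱ]
      exact (condExp_ae_eq_integral_condDistrib hH hξ.aemeasurable hg.stronglyMeasurable
        (hgi.comp_measurable hξ)).symm)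
  have hmem : ∀ q, MemLp (ratEval d q) 2 (μ.map ξ) := fun q ↦
    IsGaussian.memLp_dual _ (ratEval d q) 2 (by simp)
  have hform : ∀ᵐ ω ∂μ, HasGaussianForm d (κ (H ω)) := by
    have h1 : ∀ᵐ ω ∂μ, ∀ (q : ℕ →₀ ℚ) (s : ℚ), Tendsto
        (fun n ↦ ∫ f, Real.cos (s * ratEval d q f) ∂(P n ω : Measure C(𝕏, ℝ)))
        atTop (𝓝 (∫ f, Real.cos (s * ratEval d q f) ∂(κ (H ω)))) :=
      ae_all_iff.2 fun q ↦ ae_all_iff.2 fun s ↦ hκ (by fun_prop) (integrable_cos _ _ _)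
    have h2 : ∀ᵐ ω ∂μ, ∀ (q : ℕ →₀ ℚ) (s : ℚ), Tendsto
        (fun n ↦ ∫ f, Real.sin (s * ratEval d q f) ∂(P n ω : Measure C(𝕏, ℝ)))
        atTop (𝓝 (∫ f, Real.sin (s * ratEval d q f) ∂(κ (H ω)))) :=
      ae_all_iff.2 fun q ↦ ae_all_iff.2 fun s ↦ hκ (by fun_prop) (integrable_sin _ _ _)
    have h3 : ∀ᵐ ω ∂μ, ∀ q : ℕ →₀ ℚ, Tendsto
        (fun n ↦ ∫ f, ratEval d q f ∂(P n ω : Measure C(𝕏, ℝ)))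
        atTop (𝓝 (∫ f, ratEval d q f ∂(κ (H ω)))) :=
      ae_all_iff.2 fun q ↦ hκ (by fun_prop) ((hmem q).integrable (by simp))
    have h4 : ∀ᵐ ω ∂μ, ∀ q : ℕ →₀ ℚ, Tendsto
        (fun n ↦ ∫ f, ratEval d q f ^ 2 ∂(P n ω : Measure C(𝕏, ℝ)))
        atTop (𝓝 (∫ f, ratEval d q f ^ 2 ∂(κ (H ω)))) :=
      ae_all_iff.2 fun q ↦ hκ (by fun_prop) (hmem q).integrable_sq
    filter_upwards [h1, h2, h3, h4] with ω h1 h2 h3 h4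
    refine HasGaussianForm.of_tendsto (fun n ↦ ?_) h1 h2 h3 h4
    have := (P n ω).2
    exact hasGaussianForm_of_isGaussian _
  -- the exceptional null set is measurable for the conditioning sigma-algebra, so that the
  -- conditional law can be replaced there by an arbitrary Gaussian measure
  classical
  let P' : β → GaussianMeasure 𝕏 := fun b ↦
    if h : HasGaussianForm d (κ b) then ⟨κ b, h.isGaussian hd⟩
    else ⟨Measure.dirac 0, inferInstance⟩
  have hP' : Measurable P' := by
    have hm : Measurable fun b ↦ (P' b : Measure C(𝕏, ℝ)) := by
      have e : (fun b ↦ (P' b : Measure C(𝕏, ℝ))) = fun b ↦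
          if HasGaussianForm d (κ b) then κ b else Measure.dirac 0 := by
        funext b
        by_cases h : HasGaussianForm d (κ b) <;> simp [P', h]
      rw [e]
      exact Measurable.ite (measurableSet_hasGaussianForm κ) κ.measurable measurable_const
    exact hm.subtype_mk (h := fun b ↦ (P' b).2)
  refine ⟨fun ω ↦ P' (H ω), hP'.comp (comap_measurable H), fun A hA ↦ ?_⟩
  refine Filter.EventuallyEq.trans ?_ (condDistrib_ae_eq_condExp hH hξ hA)
  filter_upwards [hform] with ω hω
  simp only [P', dif_pos hω]
  rfl

/-- Gaussian conditional laws along a filtration yield a Gaussian conditional law given the limit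
sigma-algebra. -/
theorem exists_isGaussianCondLaw_iSup [Nonempty 𝕏] (hξ : Measurable ξ)
    (hξ_gauss : IsGaussian (μ.map ξ)) (hP : ∀ n, IsGaussianCondLaw μ ξ (ℱ n) (P n)) :
    ∃ P', IsGaussianCondLaw μ ξ (⨆ n, ℱ n) P' := by
  have key := @exists_isGaussianCondLaw_comap 𝕏 _ _ Ω mΩ μ _ ξ ℱ P _ hξ hξ_gauss hP Ω (⨆ n, ℱ n)
    id (measurable_id'' (iSup_le ℱ.le))
  rw [MeasurableSpace.comap_id] at key
  exact key rfl

/-- Along a filtration, the Gaussian conditional laws converge almost surely. -/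
theorem ae_gaussianTendsto [Nonempty 𝕏] (hξ : Measurable ξ) (hξ_gauss : IsGaussian (μ.map ξ))
    (hP : ∀ n, IsGaussianCondLaw μ ξ (ℱ n) (P n)) {P' : Ω → GaussianMeasure 𝕏}
    (hP' : IsGaussianCondLaw μ ξ (⨆ n, ℱ n) P') :
    ∀ᵐ ω ∂μ, GaussianTendsto (fun n ↦ P n ω) (P' ω) := by
  obtain ⟨t, φ, h⟩ := exists_interpolationScheme (TopologicalSpace.denseRange_denseSeq 𝕏)
  set d := TopologicalSpace.denseSeq 𝕏
  have hlim : ∀ {g : C(𝕏, ℝ) → ℝ}, Continuous g → Integrable g (μ.map ξ) →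
      ∀ᵐ ω ∂μ, Tendsto (fun n ↦ ∫ f, g f ∂(P n ω : Measure C(𝕏, ℝ))) atTop
        (𝓝 (∫ f, g f ∂(P' ω : Measure C(𝕏, ℝ)))) := fun {g} hg hgi ↦
    ae_tendsto_integral hξ hP hg hgi
      (hP'.integral_ae_eq_condExp (iSup_le ℱ.le) hξ hg hgi)
  have hev := memLp_eval (μ.map ξ)
  have hno := memLp_norm (μ.map ξ)
  have her := fun k ↦ memLp_norm_clm (μ.map ξ) (interpError d (t k) (φ k))
  have h1 := ae_all_iff.2 fun i ↦ hlim (g := fun f ↦ f (d i)) (by fun_prop)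
    ((hev _).integrable (by simp))
  have h2 := ae_all_iff.2 fun i ↦ ae_all_iff.2 fun j ↦ hlim (g := fun f ↦ f (d i) * f (d j))
    (by fun_prop) ((hev _).integrable_mul (hev _))
  have h3 := hlim (g := fun f ↦ ‖f‖) (by fun_prop) (hno.integrable (by simp))
  have h4 := ae_all_iff.2 fun k ↦ hlim (g := fun f ↦ ‖interpError d (t k) (φ k) f‖) (by fun_prop)
    ((her k).integrable (by simp))
  have h5 := ae_all_iff.2 fun k ↦ hlim (g := fun f ↦ ‖interpError d (t k) (φ k) f‖ * ‖f‖)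
    (by fun_prop) ((her k).integrable_mul hno)
  filter_upwards [h1, h2, h3, h4, h5] with ω h1 h2 h3 h4 h5
  exact gaussianTendsto_of_tendsto_integral h h1 h2 h3 h4 h5

end Limit

end SequentialDesign

theorem mainTheorem12
    {𝕏 : Type*} [MetricSpace 𝕏] [CompactSpace 𝕏] [MeasurableSpace 𝕏] [BorelSpace 𝕏]
    {Ω : Type*} [MeasurableSpace Ω] (μ : Measure Ω) [IsProbabilityMeasure μ]
    -- a Gaussian process on `𝕏` with continuous sample paths
    (ξ : Ω → C(𝕏, ℝ)) (hξ_meas : ∀ x : 𝕏, Measurable (fun ω ↦ ξ ω x))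
    (hξ_gauss : IsGaussianProcess (fun (x : 𝕏) (ω : Ω) ↦ ξ ω x) μ)
    -- the standard deviation of the noise
    (τ : 𝕏 → ℝ) (hτ_cont : Continuous τ) (hτ_nonneg : ∀ x, 0 ≤ τ x)
    -- i.i.d. standard normal variables, independent of the process
    (U : ℕ → Ω → ℝ) (hU_meas : ∀ n, Measurable (U n))
    (hU_law : ∀ n, μ.map (U n) = gaussianReal 0 1) (hU_indep : iIndepFun U μ)
    (hUξ : IndepFun (fun (ω : Ω) (x : 𝕏) ↦ ξ ω x) (fun (ω : Ω) (n : ℕ) ↦ U n ω) μ)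
    -- a sequential design
    (X : ℕ → Ω → 𝕏) (hX : SequentialDesign.IsSequentialDesign ξ τ U X) :
    (∀ n, ∃ P : Ω → SequentialDesign.GaussianMeasure 𝕏,
      SequentialDesign.IsGaussianCondLaw μ ξ (SequentialDesign.obsSigma ξ τ U X n) P) ∧
    ∃ Pinf : Ω → SequentialDesign.GaussianMeasure 𝕏,
      SequentialDesign.IsGaussianCondLaw μ ξ (SequentialDesign.obsSigmaInf ξ τ U X) Pinf ∧
      ∀ P : ℕ → Ω → SequentialDesign.GaussianMeasure 𝕏,
        (∀ n, SequentialDesign.IsGaussianCondLaw μ ξ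
          (SequentialDesign.obsSigma ξ τ U X n) (P n)) →
        ∀ᵐ ω ∂μ, SequentialDesign.GaussianTendsto (fun n ↦ P n ω) (Pinf ω) := by
  obtain ⟨ω₀⟩ : Nonempty Ω := nonempty_of_isProbabilityMeasure μ
  have : Nonempty 𝕏 := ⟨X 0 ω₀⟩
  have hξ : Measurable ξ := SequentialDesign.measurable_of_measurable_eval hξ_meas
  have h1 := hX.exists_isGaussianCondLaw hξ_meas hξ_gauss hτ_cont.measurable hU_meas hU_law
    hU_indep hUξ
  refine ⟨h1, ?_⟩
  let ℱ : Filtration ℕ ‹MeasurableSpace Ω› :=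
    ⟨SequentialDesign.obsSigma ξ τ U X, SequentialDesign.obsSigma_mono,
      fun n ↦ hX.obsSigma_le hτ_cont.measurable hξ fun i _ ↦ hU_meas i⟩
  have hgauss := SequentialDesign.isGaussian_map_of_isGaussianProcess hξ hξ_gauss
  choose P₀ hP₀ using h1
  obtain ⟨Pinf, hPinf⟩ := SequentialDesign.exists_isGaussianCondLaw_iSup (ℱ := ℱ) hξ hgauss hP₀
  exact ⟨Pinf, hPinf, fun P hP ↦
    SequentialDesign.ae_gaussianTendsto (ℱ := ℱ) hξ hgauss hP hPinf⟩
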